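/- Consider bipartite graphs $G=(A\cup B,E)$ in the two-sided model with one-sided ties: every agent $a\in A$ ranks her neighbours strictly by a preference list, and every $b\in B$ is indifferent between all of its neighbours. Being unmatched is the worst outcome for every vertex. Thus $a\in A$ prefers a matching $M$ to a matching $N$ if she is matched in $M$ and is either unmatched in $N$ or prefers her partner in $M$ to her partner in $N$, while $b\in B$ prefers $M$ to $N$ if and only if $b$ is matched in $M$ and unmatched in $N$. Let $\phi(M,N)$ be the number of vertices of $A\cup B$ that prefer $M$ to $N$. A matching $M$ is popular if $\phi(M,N)\ge\phi(N,M)$ for every matching $N$ of $G$. Theorem. There is an algorithm (a random access program in which every assignment, addition, subtraction, array access and test takes one step) that, given $k\ge 1$ instances $\mathcal I_1,\dots,\mathcal I_k$ of this model which share the same underlying graph and differ only in the preferences of a single agent of $A$ (that is, at most one agent has different preference lists in different instances), decides whether there is a matching that is popular in all of $\mathcal I_1,\dots,\mathcal I_k$. Its running time is bounded by a polynomial in the size of the input, that is, in the sum of the number $|A|+|B|$ of vertices, the number $k$ of instances, and the total length of all preference lists. -/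

import Mathlib

/-! ## Bipartite instances with strict preferences on one side and one large tie on the other -/

namespace PopularMatching

/-- An instance on the bipartite graph with sides `A` (agents) and `B` (jobs): every agent has a
strict preference list of her neighbours, best first.  Every job puts all of its neighbours into a
single tie, so that jobs carry no further data. -/
structure Instance (A B : Type*) where
  pref : A → List B
  nodup : ∀ a, (pref a).Nodup

namespace Instance

variable {A B : Type*}

/-- The edges of the underlying graph: `b` is a neighbour of `a` iff `a` lists `b`. -/
def Adj (I : Instance A B) (a : A) (b : B) : Prop := b ∈ I.pref a

/-- `b ≻ₐ b'`: both are neighbours of `a`, and `b` comes before `b'` in the list of `a`. -/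
def Better [DecidableEq B] (I : Instance A B) (a : A) (b b' : B) : Prop :=
  b ∈ I.pref a ∧ b' ∈ I.pref a ∧ (I.pref a).idxOf b < (I.pref a).idxOf b'

/-- A matching: a set of pairwise non-adjacent edges of the graph. -/
structure IsMatching (I : Instance A B) (M : Finset (A × B)) : Prop where
  edge : ∀ a b, (a, b) ∈ M → I.Adj a b
  left_unique : ∀ a b b', (a, b) ∈ M → (a, b') ∈ M → b = b'
  right_unique : ∀ a a' b, (a, b) ∈ M → (a', b) ∈ M → a = a'

/-- The vertex `v` prefers the matching `M` to the matching `N`.  An agent does so iff she is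
matched in `M` and is either unmatched in `N` or matched in `N` to someone worse; a job does so iff
it is matched in `M` and unmatched in `N`. -/
def Prefers [DecidableEq B] (I : Instance A B) (M N : Finset (A × B)) : A ⊕ B → Prop
  | .inl a => ∃ b, (a, b) ∈ M ∧ ∀ b', (a, b') ∈ N → I.Better a b b'
  | .inr b => (∃ a, (a, b) ∈ M) ∧ ¬ ∃ a, (a, b) ∈ N

/-- `φ(M, N)`: the number of vertices that prefer `M` to `N`. -/
noncomputable def votes [DecidableEq B] (I : Instance A B) (M N : Finset (A × B)) : ℕ :=
  Set.ncard {v : A ⊕ B | I.Prefers M N v}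

/-- `M` is a popular matching: no matching gets more votes against `M` than `M` gets against it. -/
def IsPopular [DecidableEq B] (I : Instance A B) (M : Finset (A × B)) : Prop :=
  I.IsMatching M ∧ ∀ N, I.IsMatching N → I.votes N M ≤ I.votes M N

end Instance

/-- An input of the decision problem: instances `I₁, …, I_k` (`k ≥ 1`) on the same graph such that
at most one agent has different preferences in different instances.  This agent is not told to the
algorithm. -/
structure Input where
  nA : ℕ
  nB : ℕ
  k : ℕ
  k_pos : 0 < k
  inst : Fin k → Instance (Fin nA) (Fin nB)
  same_graph : ∀ i j a b, (inst i).Adj a b ↔ (inst j).Adj a b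
  one_agent : {a | ∃ i j, (inst i).pref a ≠ (inst j).pref a}.Subsingleton

/-- The input written as a sequence of numbers: the number of agents, of jobs and of instances,
then, instance by instance and agent by agent, the length of the preference list followed by its
entries, best first. -/
def Input.encode (x : Input) : List ℕ :=
  x.nA :: x.nB :: x.k ::
    (List.finRange x.k).flatMap fun i =>
      (List.finRange x.nA).flatMap fun a =>
        ((x.inst i).pref a).length :: ((x.inst i).pref a).map fun b => (b : ℕ)

/-- The size of the input: the number of vertices plus the number of instances plus the total
length of all preference lists. -/
def Input.size (x : Input) : ℕ :=
  x.nA + x.nB + x.k + ∑ i, ∑ a, ((x.inst i).pref a).length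

/-- Some matching is popular in all the instances. -/
def Input.HasRobustPopularMatching (x : Input) : Prop :=
  ∃ M : Finset (Fin x.nA × Fin x.nB), ∀ i, (x.inst i).IsPopular M

end PopularMatching

/-! ## Random access programs with a step count -/

namespace RandomAccess

/-- Memory: variables and arrays of natural numbers.  A program mentions only finitely many
variables and arrays, by fixed names; the index into an array is computed at run time. -/
structure State where
  var : ℕ → ℕ
  arr : ℕ → ℕ → ℕ

/-- Write `v` into the variable `x`. -/
def State.setVar (s : State) (x v : ℕ) : State :=
  { s with var := Function.update s.var x v }

/-- Write `v` into the cell `i` of the array `r`. -/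
def State.setArr (s : State) (r i v : ℕ) : State :=
  { s with arr := Function.update s.arr r (Function.update (s.arr r) i v) }

/-- Programs.  Arithmetic is addition and truncated subtraction only: without multiplication or
shifts, unit-cost polynomial time is Turing machine polynomial time. -/
inductive Program where
  /-- do nothing -/
  | skip : Program
  /-- `x := c` -/
  | const (x c : ℕ) : Program
  /-- `x := y` -/
  | copy (x y : ℕ) : Program
  /-- `x := y + z` -/
  | add (x y z : ℕ) : Program
  /-- `x := y - z`, and `0` if `y < z` -/
  | sub (x y z : ℕ) : Program
  /-- `x := r[y]` -/
  | load (x r y : ℕ) : Program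
  /-- `r[y] := x` -/
  | store (r y x : ℕ) : Program
  /-- first `p`, then `q` -/
  | seq (p q : Program) : Program
  /-- if `x ≠ 0` then `p`, else `q` -/
  | cond (x : ℕ) (p q : Program) : Program
  /-- as long as `x ≠ 0`, do `p` -/
  | loop (x : ℕ) (p : Program) : Program

/-- `Exec p s t s'`: started in the state `s`, the program `p` halts after exactly `t` steps in the
state `s'`.  Every assignment and every test takes one step. -/
inductive Exec : Program → State → ℕ → State → Prop where
  | skip (s : State) : Exec .skip s 1 s
  | const (s : State) (x c : ℕ) : Exec (.const x c) s 1 (s.setVar x c)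
  | copy (s : State) (x y : ℕ) : Exec (.copy x y) s 1 (s.setVar x (s.var y))
  | add (s : State) (x y z : ℕ) : Exec (.add x y z) s 1 (s.setVar x (s.var y + s.var z))
  | sub (s : State) (x y z : ℕ) : Exec (.sub x y z) s 1 (s.setVar x (s.var y - s.var z))
  | load (s : State) (x r y : ℕ) : Exec (.load x r y) s 1 (s.setVar x (s.arr r (s.var y)))
  | store (s : State) (r y x : ℕ) : Exec (.store r y x) s 1 (s.setArr r (s.var y) (s.var x))
  | seq {p q : Program} {s s₁ s₂ : State} {t₁ t₂ : ℕ} :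
      Exec p s t₁ s₁ → Exec q s₁ t₂ s₂ → Exec (.seq p q) s (t₁ + t₂) s₂
  | cond_true {x : ℕ} {p q : Program} {s s₁ : State} {t : ℕ} :
      s.var x ≠ 0 → Exec p s t s₁ → Exec (.cond x p q) s (t + 1) s₁
  | cond_false {x : ℕ} {p q : Program} {s s₁ : State} {t : ℕ} :
      s.var x = 0 → Exec q s t s₁ → Exec (.cond x p q) s (t + 1) s₁
  | loop_stop {x : ℕ} {p : Program} {s : State} :
      s.var x = 0 → Exec (.loop x p) s 1 s
  | loop_step {x : ℕ} {p : Program} {s s₁ s₂ : State} {t₁ t₂ : ℕ} :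
      s.var x ≠ 0 → Exec p s t₁ s₁ → Exec (.loop x p) s₁ t₂ s₂ →
        Exec (.loop x p) s (t₁ + t₂ + 1) s₂

/-- The initial state on the input sequence `w`: `w` stands in the array `0` and its length in the
variable `0`; everything else is `0`. -/
def State.init (w : List ℕ) : State where
  var := fun x => if x = 0 then w.length else 0
  arr := fun r i => if r = 0 then w.getD i 0 else 0

/-- The property `P` of the inputs `x : α`, written as `encode x`, is decided by one program in
time polynomial in `size x`: on every input the program halts within the time bound, and its
answer, the final value of the variable `0`, is nonzero exactly if `P x`. -/
def PolyTimeDecidable {α : Type*} (encode : α → List ℕ) (size : α → ℕ) (P : α → Prop) : Prop :=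
  ∃ (p : Program) (T : Polynomial ℕ), ∀ x : α, ∃ (t : ℕ) (s : State),
    Exec p (State.init (encode x)) t s ∧ t ≤ T.eval (size x) ∧ (s.var 0 ≠ 0 ↔ P x)

end RandomAccess

/-!
# Popular matchings that are robust against the changes of one agent

*Certificates.* For a fixed matching `M`, the competing matchings `N` are the feasible solutions of
an assignment problem, in which `N` has the weight `φ(N, M) - φ(M, N)`. So `M` is popular iff this
problem has a dual solution of value `0`. Such a solution is integral, takes only the values `-1`,
`0` and `1`, and is determined by its values on the jobs; they are written as `1 - d b` with a discount
`d b ≤ 2` (`Certifies`). If only one agent has different preferences in different instances, then a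
matching which is popular in all instances has a common certificate (`exists_certifies`): give every
edge its best weight over all instances. A competing matching uses at most one edge at the varying
agent, so that its weight is at most its weight in one single instance, and thus not positive.

*Equilibria.* The conditions on `d` and `M` say that `M` is an equilibrium of a market, in which
every agent is matched to a job that she demands at the discounts `d`, and all jobs of discount at
most `1` are matched (`IsEquilibrium`, `Input.hasRobustPopularMatching_iff`). Being unmatched is
modelled by a private last resort of discount `1`. The unmatched jobs are those which give the full
discount `2`: the extra vote of an unmatched job has the same effect as this discount. The demand has
two properties of substitutes, `Demands.of_le` and `Demands.not_of_lt`, although it does not come from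
utilities.

*The auction.* These properties suffice for an auction that starts with the discount `0` and keeps
`d` below all equilibria. If the jobs of discount at most `1` cannot all be matched to agents who
demand them, then a job that remains uncovered has a larger discount in every equilibrium
(`IsEquilibrium.lt_of_violates`), and its discount is raised. Otherwise an equilibrium exists iff also
all agents can be matched at the discounts `d` (`IsLowerBound.saturable_agents_iff`), by the theorem
of Mendelsohn and Dulmage in one direction and an exchange argument in the other one.

*The program.* Bipartite matchings are found by a price method (`PriceInv`), which needs no search
for augmenting paths: a row without a column takes over its cheapest neighbour from the owner, and
the price of this column increases by `1`. If all neighbours of a row have reached a price which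
exceeds the number of columns, then some smaller price does not occur, and the columns above this
price violate Hall's condition. The programs are analysed with a Hoare calculus (`HaltsWithin`) that
bounds the number of steps.
-/

/-! ### Running time and frames of random access programs -/

namespace RandomAccess

namespace Program

/-- The programs of the list, one after the other. -/
def block : List Program → Program
  | [] => .skip
  | p :: l => .seq p (block l)

/-- The program `p` for `x = v - 1, …, 1, 0`, where `v` is the initial value of the variable `n`.
The variable `1` has to hold the number one. -/
def countdown (x n : ℕ) (p : Program) : Program :=
  .seq (.copy x n) (.loop x (.seq (.sub x x 1) p))

/-- Programs without loops. -/
def LoopFree : Program → Prop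
  | .seq p q => p.LoopFree ∧ q.LoopFree
  | .cond _ p q => p.LoopFree ∧ q.LoopFree
  | .loop _ _ => False
  | _ => True

/-- The final state of a loop-free program; on loops the value is irrelevant. -/
def eval : Program → State → State
  | .skip, s => s
  | .const x c, s => s.setVar x c
  | .copy x y, s => s.setVar x (s.var y)
  | .add x y z, s => s.setVar x (s.var y + s.var z)
  | .sub x y z, s => s.setVar x (s.var y - s.var z)
  | .load x r y, s => s.setVar x (s.arr r (s.var y))
  | .store r y x, s => s.setArr r (s.var y) (s.var x)
  | .seq p q, s => q.eval (p.eval s)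
  | .cond x p q, s => if s.var x = 0 then q.eval s else p.eval s
  | .loop _ _, s => s

/-- A bound for the number of steps of a loop-free program. -/
def cost : Program → ℕ
  | .seq p q => p.cost + q.cost
  | .cond _ p q => p.cost + q.cost + 1
  | _ => 1

/-- The variables which occur as targets of assignments. -/
def writtenVars : Program → List ℕ
  | .const x _ | .copy x _ | .add x _ _ | .sub x _ _ | .load x _ _ => [x]
  | .seq p q | .cond _ p q => p.writtenVars ++ q.writtenVars
  | .loop _ p => p.writtenVars
  | _ => []

/-- The arrays which occur as targets of assignments. -/
def writtenArrs : Program → List ℕ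
  | .store r _ _ => [r]
  | .seq p q | .cond _ p q => p.writtenArrs ++ q.writtenArrs
  | .loop _ p => p.writtenArrs
  | _ => []

end Program

/-- The states `s` and `s'` differ at most in the variables and arrays written by `p`. -/
structure Frame (p : Program) (s s' : State) : Prop where
  var : ∀ x, x ∉ p.writtenVars → s'.var x = s.var x
  arr : ∀ r, r ∉ p.writtenArrs → s'.arr r = s.arr r

theorem Frame.refl (p : Program) (s : State) : Frame p s s := ⟨fun _ _ => rfl, fun _ _ => rfl⟩

theorem Frame.trans {p : Program} {s s₁ s₂ : State} (h₁ : Frame p s s₁) (h₂ : Frame p s₁ s₂) :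
    Frame p s s₂ :=
  ⟨fun x hx => (h₂.var x hx).trans (h₁.var x hx), fun r hr => (h₂.arr r hr).trans (h₁.arr r hr)⟩

theorem Frame.of_subset {p q : Program} {s s' : State} (h : Frame p s s')
    (hv : p.writtenVars ⊆ q.writtenVars) (ha : p.writtenArrs ⊆ q.writtenArrs) : Frame q s s' :=
  ⟨fun x hx => h.var x fun h' => hx (hv h'), fun r hr => h.arr r fun h' => hr (ha h')⟩

theorem Exec.frame {p : Program} {s s' : State} {t : ℕ} (h : Exec p s t s') : Frame p s s' := by
  induction h with
  | skip s => exact .refl _ _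
  | const s x c => exact ⟨fun y hy => by simp_all [Program.writtenVars, State.setVar], fun _ _ => rfl⟩
  | copy s x c => exact ⟨fun y hy => by simp_all [Program.writtenVars, State.setVar], fun _ _ => rfl⟩
  | add s x c => exact ⟨fun y hy => by simp_all [Program.writtenVars, State.setVar], fun _ _ => rfl⟩
  | sub s x c => exact ⟨fun y hy => by simp_all [Program.writtenVars, State.setVar], fun _ _ => rfl⟩
  | load s x c => exact ⟨fun y hy => by simp_all [Program.writtenVars, State.setVar], fun _ _ => rfl⟩
  | store s r => exact ⟨fun _ _ => rfl, fun y hy => by simp_all [Program.writtenArrs, State.setArr]⟩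
  | seq _ _ ih₁ ih₂ =>
    exact (ih₁.of_subset (by simp [Program.writtenVars]) (by simp [Program.writtenArrs])).trans
      (ih₂.of_subset (by simp [Program.writtenVars]) (by simp [Program.writtenArrs]))
  | cond_true _ _ ih =>
    exact ih.of_subset (by simp [Program.writtenVars]) (by simp [Program.writtenArrs])
  | cond_false _ _ ih =>
    exact ih.of_subset (by simp [Program.writtenVars]) (by simp [Program.writtenArrs])
  | loop_stop _ => exact .refl _ _
  | loop_step _ _ _ ih₁ ih₂ =>
    exact (ih₁.of_subset (by simp [Program.writtenVars]) (by simp [Program.writtenArrs])).trans ih₂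

/-- Started in `s`, the program `p` halts after at most `T` steps in a state with property `Q`. -/
def HaltsWithin (p : Program) (T : ℕ) (s : State) (Q : State → Prop) : Prop :=
  ∃ t s', Exec p s t s' ∧ t ≤ T ∧ Q s'

namespace HaltsWithin

variable {p q : Program} {T T₁ T₂ : ℕ} {s : State} {Q R : State → Prop}

theorem frame (h : HaltsWithin p T s Q) : HaltsWithin p T s fun s' => Q s' ∧ Frame p s s' := by
  obtain ⟨t, s', h, ht, hQ⟩ := h
  exact ⟨t, s', h, ht, hQ, h.frame⟩

theorem mono (h : HaltsWithin p T₁ s R) (hT : T₁ ≤ T₂) (hQ : ∀ s', R s' → Q s') :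
    HaltsWithin p T₂ s Q := by
  obtain ⟨t, s', h, ht, hR⟩ := h
  exact ⟨t, s', h, ht.trans hT, hQ s' hR⟩

/-- Consequence rule with the frame of the program at hand. -/
theorem imp (h : HaltsWithin p T₁ s R) (hT : T₁ ≤ T₂) (hQ : ∀ s', Frame p s s' → R s' → Q s') :
    HaltsWithin p T₂ s Q :=
  h.frame.mono hT fun s' h => hQ s' h.2 h.1

theorem of_loopFree (hp : p.LoopFree) (hT : p.cost ≤ T) (hQ : Q (p.eval s)) :
    HaltsWithin p T s Q := by
  suffices h : HaltsWithin p p.cost s (· = p.eval s) from h.mono hT fun s' h => h ▸ hQ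
  clear hT hQ
  induction p generalizing s with
  | skip => exact ⟨_, _, .skip s, le_rfl, rfl⟩
  | const x c => exact ⟨_, _, .const s x c, le_rfl, rfl⟩
  | copy x y => exact ⟨_, _, .copy s x y, le_rfl, rfl⟩
  | add x y z => exact ⟨_, _, .add s x y z, le_rfl, rfl⟩
  | sub x y z => exact ⟨_, _, .sub s x y z, le_rfl, rfl⟩
  | load x r y => exact ⟨_, _, .load s x r y, le_rfl, rfl⟩
  | store r y x => exact ⟨_, _, .store s r y x, le_rfl, rfl⟩
  | seq p q ihp ihq =>
    obtain ⟨t₁, _, h₁, ht₁, rfl⟩ := ihp hp.1 (s := s)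
    obtain ⟨t₂, _, h₂, ht₂, rfl⟩ := ihq hp.2 (s := p.eval s)
    exact ⟨_, _, .seq h₁ h₂, Nat.add_le_add ht₁ ht₂, rfl⟩
  | cond x p q ihp ihq =>
    by_cases hx : s.var x = 0
    · obtain ⟨t, _, h, ht, rfl⟩ := ihq hp.2 (s := s)
      exact ⟨_, _, .cond_false hx h, by simp only [Program.cost]; omega,
        by simp [Program.eval, hx]⟩
    · obtain ⟨t, _, h, ht, rfl⟩ := ihp hp.1 (s := s)
      exact ⟨_, _, .cond_true hx h, by simp only [Program.cost]; omega,
        by simp [Program.eval, hx]⟩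
  | loop x p => exact hp.elim

theorem seq (h₁ : HaltsWithin p T₁ s R) (h₂ : ∀ s₁, Frame p s s₁ → R s₁ → HaltsWithin q T₂ s₁ Q) :
    HaltsWithin (.seq p q) (T₁ + T₂) s Q := by
  obtain ⟨t₁, s₁, e₁, ht₁, hR, hF⟩ := h₁.frame
  obtain ⟨t₂, s₂, e₂, ht₂, hQ⟩ := h₂ s₁ hF hR
  exact ⟨_, s₂, .seq e₁ e₂, Nat.add_le_add ht₁ ht₂, hQ⟩

theorem cons {l : List Program} (h₁ : HaltsWithin p T₁ s R)
    (h₂ : ∀ s₁, Frame p s s₁ → R s₁ → HaltsWithin (.block l) T₂ s₁ Q) :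
    HaltsWithin (.block (p :: l)) (T₁ + T₂) s Q :=
  h₁.seq h₂

/-- The leading instruction of a block costs one step. -/
theorem cons_step {l : List Program} {T : ℕ} (hp : p.LoopFree) (hc : p.cost = 1)
    (h : HaltsWithin (.block l) T (p.eval s) Q) : HaltsWithin (.block (p :: l)) (T + 1) s Q :=
  ((of_loopFree hp hc.le (Q := (· = p.eval s)) rfl).cons fun _ _ hs => hs ▸ h).mono (by omega)
    fun _ h => h

theorem nil (hQ : Q s) : HaltsWithin (.block []) (T + 1) s Q :=
  ⟨1, s, .skip s, by omega, hQ⟩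

theorem cond {x : ℕ} (h₁ : s.var x ≠ 0 → HaltsWithin p T s Q)
    (h₂ : s.var x = 0 → HaltsWithin q T s Q) : HaltsWithin (.cond x p q) (T + 1) s Q := by
  by_cases hx : s.var x = 0
  · obtain ⟨t, s', h, ht, hQ⟩ := h₂ hx
    exact ⟨_, s', .cond_false hx h, by omega, hQ⟩
  · obtain ⟨t, s', h, ht, hQ⟩ := h₁ hx
    exact ⟨_, s', .cond_true hx h, by omega, hQ⟩

/-- Loops with an invariant and a variant, which decreases unless the loop is about to stop. -/
theorem loop {x : ℕ} (Inv : State → Prop) (μ : State → ℕ)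
    (step : ∀ s₁, Frame p s s₁ → Inv s₁ → s₁.var x ≠ 0 →
      HaltsWithin p T s₁ fun s₂ => Inv s₂ ∧ (s₂.var x = 0 ∨ μ s₂ < μ s₁))
    (h₀ : Inv s) :
    HaltsWithin (.loop x p) ((μ s + 1) * (T + 1) + 1) s fun s' => Inv s' ∧ s'.var x = 0 := by
  suffices H : ∀ n s₁, (s₁.var x = 0 ∨ μ s₁ < n) → Frame p s s₁ → Inv s₁ →
      HaltsWithin (.loop x p) (n * (T + 1) + 1) s₁ fun s' => Inv s' ∧ s'.var x = 0 from
    H _ s (.inr (Nat.lt_succ_self _)) (.refl _ _) h₀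
  intro n
  induction n with
  | zero =>
    intro s₁ h₁ hF hI
    have hx : s₁.var x = 0 := h₁.resolve_right (by omega)
    exact ⟨1, s₁, Exec.loop_stop hx, by omega, hI, hx⟩
  | succ n ih =>
    intro s₁ h₁ hF hI
    by_cases hx : s₁.var x = 0
    · exact ⟨1, s₁, Exec.loop_stop hx, by omega, hI, hx⟩
    obtain ⟨t₁, s₂, e₁, ht₁, hI₂, hμ⟩ := step s₁ hF hI hx
    obtain ⟨t₂, s₃, e₂, ht₂, hQ⟩ :=
      ih s₂ (hμ.imp_right fun h => by have := h₁.resolve_left hx; omega) (hF.trans e₁.frame) hI₂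
    exact ⟨_, s₃, .loop_step hx e₁ e₂, by rw [Nat.add_mul]; omega, hQ⟩

/-- Counting loops.  `Inv i` says what is known when the values `≥ i` have been dealt with; it must
not depend on the counter. -/
theorem countdown {x n : ℕ} (Inv : ℕ → State → Prop) (hx : x ∉ p.writtenVars)
    (h1x : 1 ≠ x) (h1 : 1 ∉ p.writtenVars) (hs : s.var 1 = 1)
    (hInv : ∀ i s₁ v, Inv i s₁ → Inv i (s₁.setVar x v))
    (step : ∀ i < s.var n, ∀ s₁, Frame (.countdown x n p) s s₁ → s₁.var x = i → Inv (i + 1) s₁ →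
      HaltsWithin p T s₁ (Inv i))
    (h₀ : Inv (s.var n) s) :
    HaltsWithin (.countdown x n p) (s.var n * (T + 2) + 2) s (Inv 0) := by
  have key : ∀ i ≤ s.var n, ∀ s₁, Frame (.countdown x n p) s s₁ → s₁.var x = i → Inv i s₁ →
      HaltsWithin (.loop x (.seq (.sub x x 1) p)) (i * (T + 2) + 1) s₁ (Inv 0) := by
    intro i
    induction i with
    | zero =>
      intro _ s₁ _ hx0 hI
      exact ⟨1, s₁, Exec.loop_stop hx0, by omega, hI⟩
    | succ i ih =>
      intro hi s₁ hF hxi hI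
      have h1s₁ : s₁.var 1 = 1 := by
        rw [hF.var 1 (by simp [Program.countdown, Program.writtenVars, h1, h1x]), hs]
      have e₀ := Exec.sub s₁ x x 1
      rw [hxi, h1s₁, Nat.add_sub_cancel] at e₀
      have hF₀ : Frame (.countdown x n p) s (s₁.setVar x i) :=
        hF.trans (e₀.frame.of_subset (by simp [Program.countdown, Program.writtenVars])
          (by simp [Program.countdown, Program.writtenArrs]))
      obtain ⟨t₁, s₂, e₁, ht₁, hI₂⟩ := step i (by omega) _ hF₀ (by simp [State.setVar])
        (hInv _ _ i hI)
      obtain ⟨t₂, s₃, e₂, ht₂, hQ⟩ := ih (by omega) s₂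
        (hF₀.trans (e₁.frame.of_subset (by simp [Program.countdown, Program.writtenVars])
          (by simp [Program.countdown, Program.writtenArrs])))
        (by rw [e₁.frame.var x hx]; simp [State.setVar]) hI₂
      exact ⟨_, s₃, .loop_step (by omega) (.seq e₀ e₁) e₂, by rw [Nat.add_mul]; omega, hQ⟩
  obtain ⟨t, s', e, ht, hQ⟩ := key _ le_rfl (s.setVar x (s.var n))
    ⟨fun y hy => by simp_all [Program.countdown, Program.writtenVars, State.setVar],
      fun _ _ => rfl⟩ (by simp [State.setVar]) (hInv _ _ _ h₀)
  exact ⟨_, s', .seq (.copy s x n) e, by omega, hQ⟩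

end HaltsWithin

attribute [simp] Program.block Program.countdown Program.LoopFree Program.eval Program.cost
  Program.writtenVars Program.writtenArrs State.setVar State.setArr

end RandomAccess

/-! ### Duality for assignment problems -/

namespace PopularMatching

/-- A form of Egerváry's theorem: if no permutation has positive weight, then some integral dual
solution has nonpositive value.  A dual solution of least value has a tight permutation, since a
violation of Hall's condition in the tight graph would allow to decrease the value. -/
theorem exists_dual_of_perm_weight_nonpos {V : Type*} [Fintype V] [DecidableEq V] (w : V → V → ℤ)
    (hw : ∀ σ : Equiv.Perm V, ∑ v, w v (σ v) ≤ 0) :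
    ∃ u v : V → ℤ, (∀ i j, w i j ≤ u i + v j) ∧ ∑ i, u i + ∑ i, v i ≤ 0 := by
  classical
  let S : Set ℤ := {z | ∃ u v : V → ℤ, (∀ i j, w i j ≤ u i + v j) ∧ ∑ i, u i + ∑ i, v i = z}
  have hne : ∃ z, z ∈ S := by
    refine ⟨_, fun i => ∑ j, |w i j|, fun _ => 0, fun i j => ?_, rfl⟩
    rw [add_zero]
    exact (le_abs_self _).trans
      (Finset.single_le_sum (f := fun j => |w i j|) (fun _ _ => abs_nonneg _) (Finset.mem_univ j))
  have hbdd : ∀ z, z ∈ S → ∑ i, w i i ≤ z := by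
    rintro z ⟨u, v, h, rfl⟩
    rw [← Finset.sum_add_distrib]
    exact Finset.sum_le_sum fun i _ => h i i
  obtain ⟨z, ⟨u, v, huv, rfl⟩, hmin⟩ := Int.exists_least_of_bdd ⟨_, hbdd⟩ hne
  refine ⟨u, v, huv, ?_⟩
  let tight : V → Finset V := fun i => Finset.univ.filter fun j => u i + v j = w i j
  have hall : ∀ s : Finset V, s.card ≤ (s.biUnion tight).card := by
    intro s
    by_contra! hs
    have hmem : (∑ i, (if i ∈ s then u i - 1 else u i) +
        ∑ j, (if j ∈ s.biUnion tight then v j + 1 else v j)) ∈ S := by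
      refine ⟨_, _, fun i j => ?_, rfl⟩
      have hij := huv i j
      by_cases hi : i ∈ s
      · by_cases hj : j ∈ s.biUnion tight
        · simp only [hi, hj, if_true]; omega
        · have : u i + v j ≠ w i j := fun h => hj (Finset.mem_biUnion.2 ⟨i, hi, by simp [tight, h]⟩)
          simp only [hi, hj, if_true, if_false]; omega
      · by_cases hj : j ∈ s.biUnion tight <;> simp only [hi, hj, if_true, if_false] <;> omega
    have h₁ : ∑ i, (if i ∈ s then u i - 1 else u i) = ∑ i, u i - s.card := by
      have h : ∀ i, (if i ∈ s then u i - 1 else u i) = u i - if i ∈ s then 1 else 0 := by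
        intro i; split_ifs <;> ring
      rw [Finset.sum_congr rfl fun i _ => h i, Finset.sum_sub_distrib]
      simp
    have h₂ : ∑ j, (if j ∈ s.biUnion tight then v j + 1 else v j) =
        ∑ i, v i + (s.biUnion tight).card := by
      have h : ∀ j, (if j ∈ s.biUnion tight then v j + 1 else v j) =
          v j + if j ∈ s.biUnion tight then 1 else 0 := by
        intro j; split_ifs <;> ring
      rw [Finset.sum_congr rfl fun j _ => h j, Finset.sum_add_distrib]
      simp only [Finset.sum_boole, Finset.filter_mem_eq_inter, Finset.univ_inter]
    have := hmin _ hmem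
    omega
  obtain ⟨f, hf, hft⟩ := (Finset.all_card_le_biUnion_card_iff_exists_injective tight).1 hall
  let σ : Equiv.Perm V := Equiv.ofBijective f (Finite.injective_iff_bijective.1 hf)
  have hσ : ∑ i, w i (σ i) = ∑ i, u i + ∑ i, v i := by
    rw [← Equiv.sum_comp σ v, ← Finset.sum_add_distrib]
    exact Finset.sum_congr rfl fun i _ => ((Finset.mem_filter.1 (hft i)).2).symm
  exact hσ ▸ hw σ

/-! ### Popular matchings and discounts -/

section Better

variable {A B : Type*} [DecidableEq B]

theorem Instance.Better.irrefl {I : Instance A B} {a : A} {b : B} : ¬ I.Better a b b :=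
  fun h => lt_irrefl _ h.2.2

theorem Instance.Better.asymm {I : Instance A B} {a : A} {b b' : B} (h : I.Better a b b') :
    ¬ I.Better a b' b :=
  fun h' => lt_asymm h.2.2 h'.2.2

theorem Instance.better_or_better {I : Instance A B} {a : A} {b b' : B} (h : I.Adj a b)
    (h' : I.Adj a b') (hne : b ≠ b') : I.Better a b b' ∨ I.Better a b' b := by
  rcases lt_trichotomy ((I.pref a).idxOf b) ((I.pref a).idxOf b') with hlt | heq | hlt
  · exact .inl ⟨h, h', hlt⟩
  · exact absurd ((List.idxOf_inj h).1 heq) hne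
  · exact .inr ⟨h', h, hlt⟩

end Better

section Matching

variable {A B : Type*} [Fintype A] [Fintype B] [DecidableEq B]

/-- A sum over all vertices, split into the edges of a matching and the unmatched vertices. -/
theorem sum_vertices_eq [DecidableEq A] {N : Finset (A × B)}
    (hl : ∀ a b b', (a, b) ∈ N → (a, b') ∈ N → b = b')
    (hr : ∀ a a' b, (a, b) ∈ N → (a', b) ∈ N → a = a') (g : A ⊕ B → ℤ) :
    ∑ v, g v = ∑ e ∈ N, (g (.inl e.1) + g (.inr e.2)) +
      (∑ a with a ∉ N.image Prod.fst, g (.inl a) + ∑ b with b ∉ N.image Prod.snd, g (.inr b)) := by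
  have h₁ : ∑ e ∈ N, g (.inl e.1) = ∑ a ∈ N.image Prod.fst, g (.inl a) := by
    rw [Finset.sum_image]
    rintro ⟨a, b⟩ h ⟨a', b'⟩ h' (rfl : a = a')
    rw [hl a b b' h h']
  have h₂ : ∑ e ∈ N, g (.inr e.2) = ∑ b ∈ N.image Prod.snd, g (.inr b) := by
    rw [Finset.sum_image]
    rintro ⟨a, b⟩ h ⟨a', b'⟩ h' (rfl : b = b')
    rw [hr a a' b h h']
  have h₃ := Finset.sum_filter_add_sum_filter_not Finset.univ (· ∈ N.image Prod.fst)
    fun a => g (.inl a)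
  have h₄ := Finset.sum_filter_add_sum_filter_not Finset.univ (· ∈ N.image Prod.snd)
    fun b => g (.inr b)
  rw [Finset.filter_mem_eq_inter, Finset.univ_inter] at h₃ h₄
  rw [Fintype.sum_sum_type, Finset.sum_add_distrib, h₁, h₂]
  linarith

/-- The vote of the vertex `v` between `N` and `M`: `1` for `N`, `-1` for `M`, `0` otherwise. -/
noncomputable def vote (I : Instance A B) (N M : Finset (A × B)) (v : A ⊕ B) : ℤ :=
  open Classical in (if I.Prefers N M v then 1 else 0) - if I.Prefers M N v then 1 else 0

theorem sum_vote (I : Instance A B) (N M : Finset (A × B)) :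
    ∑ v, vote I N M v = I.votes N M - I.votes M N := by
  classical
  simp only [vote, Finset.sum_sub_distrib, Finset.sum_boole, Instance.votes]
  rw [Set.ncard_eq_toFinset_card', Set.ncard_eq_toFinset_card', Set.toFinset_ofPred,
    Set.toFinset_ofPred]

/-- The function `d` proves that `M` is popular in all the instances `I i`.  The integers `1 - d b`
on the jobs, with the opposite values on the partners and `0` on the unmatched agents, are a dual
solution of value `0` of the assignment problem in which a matching `N` has the weight
`φ(N, M) - φ(M, N)`.  An unmatched job has the discount `2` instead of the dual value `0`: its
additional vote for `N` makes the conditions for it the same as for a matched job of discount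
`2`. -/
structure Certifies {ι : Type*} (I : ι → Instance A B) (M : Finset (A × B)) (d : B → ℕ) :
    Prop where
  le_two : ∀ b, d b ≤ 2
  unmatched_job : ∀ b, (∀ a, (a, b) ∉ M) → d b = 2
  better : ∀ i a b b', (a, b) ∈ M → (I i).Better a b' b → d b' < d b
  worse : ∀ i a b b', (a, b) ∈ M → (I i).Better a b b' → d b' ≤ d b + 1
  unmatched_agent : ∀ i a b, (∀ b', (a, b') ∉ M) → (I i).Adj a b → d b = 0

/-- Weak duality: the vote of every vertex, or the votes of both ends of an edge of `N`, are at most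
the value of the dual solution there. -/
theorem Certifies.isPopular {ι : Type*} {I : ι → Instance A B} {M : Finset (A × B)} {d : B → ℕ}
    (h : Certifies I M d) (i : ι) (hM : (I i).IsMatching M) : (I i).IsPopular M := by
  classical
  refine ⟨hM, fun N hN => ?_⟩
  -- the dual solution described at `Certifies`
  let α : A ⊕ B → ℤ := Sum.elim
    (fun a => if h : ∃ b, (a, b) ∈ M then (d h.choose : ℤ) - 1 else 0)
    (fun b => if ∃ a, (a, b) ∈ M then 1 - (d b : ℤ) else 0)
  have hαa : ∀ a b, (a, b) ∈ M → α (.inl a) = d b - 1 := by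
    intro a b hab
    have hex : ∃ b, (a, b) ∈ M := ⟨b, hab⟩
    simp only [α, Sum.elim_inl, hex, dif_pos]
    rw [hM.left_unique a _ _ hex.choose_spec hab]
  have hαa' : ∀ a, (∀ b, (a, b) ∉ M) → α (.inl a) = 0 := by
    intro a ha
    simp [α, ha]
  have hαb : ∀ a b, (a, b) ∈ M → α (.inr b) = 1 - d b := by
    intro a b hab
    have hex : ∃ a, (a, b) ∈ M := ⟨a, hab⟩
    simp [α, hex]
  have hαb' : ∀ b, (∀ a, (a, b) ∉ M) → α (.inr b) = 0 := by
    intro b hb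
    simp [α, hb]
  have hsum : ∑ v, α v = 0 := by
    rw [sum_vertices_eq hM.left_unique hM.right_unique, Finset.sum_eq_zero, Finset.sum_eq_zero,
      Finset.sum_eq_zero]
    · rfl
    · intro b hb
      exact hαb' b fun a ha => by simp at hb; exact hb a ha
    · intro a ha
      exact hαa' a fun b hb => by simp at ha; exact ha b hb
    · rintro ⟨a, b⟩ hab
      rw [hαa a b hab, hαb a b hab]; ring
  have hle : ∑ v, (vote (I i) N M v - α v) ≤ 0 := by
    rw [sum_vertices_eq hN.left_unique hN.right_unique]
    have hb0 : ∀ b, (∀ a, (a, b) ∉ N) → vote (I i) N M (.inr b) ≤ α (.inr b) := by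
      intro b hb
      by_cases hbM : ∃ a, (a, b) ∈ M
      · obtain ⟨a, ha⟩ := hbM
        rw [hαb a b ha]
        have := h.le_two b
        have hv : vote (I i) N M (.inr b) = -1 := by
          simp [vote, Instance.Prefers, hb, show ∃ a, (a, b) ∈ M from ⟨a, ha⟩]
        omega
      · push Not at hbM
        rw [hαb' b hbM]
        simp [vote, Instance.Prefers, hb, hbM]
    have ha0 : ∀ a, (∀ b, (a, b) ∉ N) → vote (I i) N M (.inl a) ≤ α (.inl a) := by
      intro a ha
      by_cases haM : ∃ b, (a, b) ∈ M
      · obtain ⟨b, hb⟩ := haM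
        rw [hαa a b hb]
        have hv : vote (I i) N M (.inl a) = -1 := by
          simp [vote, Instance.Prefers, ha, show ∃ b, (a, b) ∈ M from ⟨b, hb⟩]
        omega
      · push Not at haM
        rw [hαa' a haM]
        simp [vote, Instance.Prefers, ha, haM]
    have hab : ∀ a b, (a, b) ∈ N →
        vote (I i) N M (.inl a) + vote (I i) N M (.inr b) ≤ α (.inl a) + α (.inr b) := by
      intro a b hab
      have hadj := hN.edge a b hab
      have hN' : ∀ b', (a, b') ∈ N ↔ b' = b :=
        fun b' => ⟨fun h => hN.left_unique a _ _ h hab, fun h => h ▸ hab⟩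
      have hNb : ∃ a, (a, b) ∈ N := ⟨a, hab⟩
      by_cases haM : ∃ c, (a, c) ∈ M
      · obtain ⟨c, hc⟩ := haM
        have hM' : ∀ b', (a, b') ∈ M ↔ b' = c :=
          fun b' => ⟨fun h => hM.left_unique a _ _ h hc, fun h => h ▸ hc⟩
        have hva : vote (I i) N M (.inl a) =
            (if (I i).Better a b c then 1 else 0) - if (I i).Better a c b then 1 else 0 := by
          simp [vote, Instance.Prefers, hN', hM']
        rw [hαa a c hc, hva]
        have hcases : (vote (I i) N M (.inr b) = 0 ∧ α (.inr b) = 1 - d b) ∨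
            (vote (I i) N M (.inr b) = 1 ∧ α (.inr b) = 0 ∧ d b = 2) := by
          by_cases hbM : ∃ a, (a, b) ∈ M
          · obtain ⟨a', ha'⟩ := hbM
            refine .inl ⟨?_, hαb a' b ha'⟩
            simp [vote, Instance.Prefers, hNb, show ∃ a, (a, b) ∈ M from ⟨a', ha'⟩]
          · have hbM' := hbM
            push Not at hbM'
            refine .inr ⟨?_, hαb' b hbM', h.unmatched_job b hbM'⟩
            simp [vote, Instance.Prefers, hNb, hbM']
        have h2 := h.le_two c
        by_cases hbc : b = c
        · subst hbc
          have := hαb a b hc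
          simp only [Instance.Better.irrefl, if_false]
          omega
        rcases Instance.better_or_better hadj (hM.edge a c hc) hbc with hb | hb
        · have := h.better i a c b hc hb
          simp only [hb, hb.asymm, if_true, if_false]
          omega
        · have := h.worse i a c b hc hb
          simp only [hb, hb.asymm, if_true, if_false]
          omega
      · push Not at haM
        have hd := h.unmatched_agent i a b haM hadj
        have hbM : ∃ a, (a, b) ∈ M := by
          by_contra! hbM
          have := h.unmatched_job b hbM
          omega
        obtain ⟨a', ha'⟩ := hbM
        have hva : vote (I i) N M (.inl a) = 1 := by
          simp [vote, Instance.Prefers, hN', haM]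
        have hvb : vote (I i) N M (.inr b) = 0 := by
          simp [vote, Instance.Prefers, hNb, show ∃ a, (a, b) ∈ M from ⟨a', ha'⟩]
        rw [hαa' a haM, hαb a' b ha', hva, hvb, hd]
        norm_num
    refine add_nonpos (Finset.sum_nonpos fun e he => ?_) (add_nonpos
      (Finset.sum_nonpos fun a ha => ?_) (Finset.sum_nonpos fun b hb => ?_))
    · have := hab e.1 e.2 he
      linarith
    · have := ha0 a fun b hb => by simp at ha; exact ha b hb
      linarith
    · have := hb0 b fun a ha => by simp at hb; exact hb a ha
      linarith
  rw [Finset.sum_sub_distrib, hsum, sum_vote] at hle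
  omega

/-- A matching which is popular in all instances has a common certificate.  The weight of an edge
at the agent `a` uses the best vote of `a` over all instances.  As only one agent varies, and a
matching has at most one edge at this agent, the votes in a single instance are at least as good
for the competing matching, so that its weight is not positive. -/
theorem exists_certifies {ι : Type*} [Nonempty ι] {I : ι → Instance A B} {M : Finset (A × B)}
    (hadj : ∀ i j a b, (I i).Adj a b ↔ (I j).Adj a b)
    (hone : {a | ∃ i j, (I i).pref a ≠ (I j).pref a}.Subsingleton)
    (hM : ∀ i, (I i).IsPopular M) : ∃ d, Certifies I M d := by
  classical
  obtain ⟨i₀⟩ := ‹Nonempty ι›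
  have hM₀ := (hM i₀).1
  -- `a` prefers `b` to `M` in some instance
  let pr : A → B → Prop := fun a b => ∃ i, ∀ c, (a, c) ∈ M → (I i).Better a b c
  let wa : A → B → ℤ := fun a b => if pr a b then 1 else if (a, b) ∈ M then 0 else -1
  let wb : B → ℤ := fun b => if ∃ a, (a, b) ∈ M then 0 else 1
  let la : A → ℤ := fun a => if ∃ b, (a, b) ∈ M then -1 else 0
  let lb : B → ℤ := fun b => if ∃ a, (a, b) ∈ M then -1 else 0
  -- a negative weight which rules out the pairs that are not edges
  let big : ℤ := -(2 * Fintype.card (A ⊕ B))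
  let w : A ⊕ B → A ⊕ B → ℤ := fun v v' => match v, v' with
    | .inl a, .inr b => if (I i₀).Adj a b then wa a b + wb b else big
    | .inl a, .inl a' => if a = a' then la a else big
    | .inr b, .inr b' => if b = b' then lb b else big
    | .inr _, .inl _ => 0
  have hwa : ∀ a b, wa a b ≤ 1 := fun a b => by simp only [wa]; split_ifs <;> norm_num
  have hwb : ∀ b, wb b ≤ 1 := fun b => by simp only [wb]; split_ifs <;> norm_num
  have hla : ∀ a, la a ≤ 0 := fun a => by simp only [la]; split_ifs <;> norm_num
  have hlb : ∀ a, lb a ≤ 0 := fun a => by simp only [lb]; split_ifs <;> norm_num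
  have hbig : big ≤ 0 := by simp only [big]; omega
  have hw2 : ∀ v v', w v v' ≤ 2 := by
    rintro (a | b) (a' | b')
    · have := hla a
      simp only [w]; split_ifs <;> linarith
    · have := hwa a b'; have := hwb b'
      simp only [w]; split_ifs <;> linarith
    · simp [w]
    · have := hlb b
      simp only [w]; split_ifs <;> linarith
  have hw : ∀ σ : Equiv.Perm (A ⊕ B), ∑ v, w v (σ v) ≤ 0 := by
    intro σ
    by_cases hσ : ∃ v, w v (σ v) = big
    · obtain ⟨v, hv⟩ := hσ
      rw [← Finset.add_sum_erase _ _ (Finset.mem_univ v), hv]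
      have := Finset.sum_le_card_nsmul (Finset.univ.erase v) (fun v => w v (σ v)) 2
        fun v _ => hw2 v _
      have hc : ((Finset.univ.erase v).card : ℤ) ≤ Fintype.card (A ⊕ B) := by
        exact_mod_cast Finset.card_le_univ _
      simp only [nsmul_eq_mul] at this
      simp only [big]
      linarith
    push Not at hσ
    let N : Finset (A × B) := Finset.univ.filter fun e => σ (.inl e.1) = .inr e.2
    have hmem : ∀ a b, (a, b) ∈ N ↔ σ (.inl a) = .inr b := fun a b => by simp [N]
    have hNadj : ∀ a b, (a, b) ∈ N → (I i₀).Adj a b := by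
      intro a b hab
      rw [hmem] at hab
      by_contra hn
      exact hσ (.inl a) (by simp [w, hab, hn])
    have hN : ∀ i, (I i).IsMatching N := by
      refine fun i => ⟨fun a b hab => (hadj i₀ i a b).1 (hNadj a b hab), ?_, ?_⟩
      · intro a b b' h h'
        rw [hmem] at h h'
        exact Sum.inr_injective (h.symm.trans h')
      · intro a a' b h h'
        rw [hmem] at h h'
        exact Sum.inl_injective (σ.injective (h.trans h'.symm))
    -- an instance whose votes dominate the weights
    obtain ⟨i, hi⟩ : ∃ i, ∀ a b, (a, b) ∈ N → pr a b →
        ∀ c, (a, c) ∈ M → (I i).Better a b c := by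
      by_cases hex : ∃ a b, (a, b) ∈ N ∧ pr a b ∧ ∃ i j, (I i).pref a ≠ (I j).pref a
      · obtain ⟨a, b, hab, ⟨i, hi⟩, hvar⟩ := hex
        refine ⟨i, fun a' b' hab' ⟨j, hj⟩ c hc => ?_⟩
        by_cases hvar' : ∃ i j, (I i).pref a' ≠ (I j).pref a'
        · obtain rfl := hone hvar hvar'
          obtain rfl := (hN i).left_unique a _ _ hab hab'
          exact hi c hc
        · push Not at hvar'
          have := hj c hc
          rwa [Instance.Better, hvar' j i] at this
      · push Not at hex
        refine ⟨i₀, fun a b hab hp c hc => ?_⟩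
        obtain ⟨j, hj⟩ := hp
        have := hj c hc
        rwa [Instance.Better, hex a b hab ⟨j, hj⟩ j i₀] at this
    have hpop := (hM i).2 N (hN i)
    have hv : ∑ v, vote (I i) N M v ≤ 0 := by rw [sum_vote]; omega
    refine le_trans ?_ hv
    rw [sum_vertices_eq (hN i).left_unique (hN i).right_unique,
      sum_vertices_eq (hN i).left_unique (hN i).right_unique]
    refine add_le_add (Finset.sum_le_sum ?_) (add_le_add (Finset.sum_le_sum ?_)
      (Finset.sum_le_sum ?_))
    · rintro ⟨a, b⟩ hab
      have hab' := (hmem a b).1 hab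
      have hN' : ∀ b', (a, b') ∈ N ↔ b' = b :=
        fun b' => ⟨fun h => (hN i).left_unique a _ _ h hab, fun h => h ▸ hab⟩
      have hNb : ∃ a, (a, b) ∈ N := ⟨a, hab⟩
      have h1 : w (.inl a) (σ (.inl a)) = wa a b + wb b := by
        simp [hab', w, hNadj a b hab]
      have h2 : w (.inr b) (σ (.inr b)) = 0 := by
        rcases hb : σ (.inr b) with a' | b'
        · simp [w]
        · by_cases hbb : b = b'
          · subst hbb
            have := σ.injective (hab'.trans hb.symm)
            simp at this
          · exact absurd (by simp [w, hb, hbb]) (hσ (.inr b))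
      have h3 : wa a b ≤ vote (I i) N M (.inl a) := by
        by_cases hp : pr a b
        · have hc := hi a b hab hp
          have h4 : (I i).Prefers N M (.inl a) := ⟨b, hab, hc⟩
          have h5 : ¬ (I i).Prefers M N (.inl a) := by
            rintro ⟨c, hc', hcb⟩
            exact (hcb b hab).asymm (hc c hc')
          simp [wa, hp, vote, h4, h5]
        · by_cases hbM : (a, b) ∈ M
          · have h5 : ¬ (I i).Prefers M N (.inl a) := by
              rintro ⟨c, hc', hcb⟩
              obtain rfl := hM₀.left_unique a _ _ hc' hbM
              exact (hcb c hab).irrefl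
            simp only [wa, hp, vote, hbM, h5, if_true, if_false]
            split_ifs <;> norm_num
          · simp only [wa, hp, vote, hbM, if_false]
            split_ifs <;> norm_num
      have h4 : wb b = vote (I i) N M (.inr b) := by
        by_cases hbM : ∃ a, (a, b) ∈ M <;>
        simp [wb, vote, Instance.Prefers, hNb, hbM]
      simp only [h1, h2]
      linarith
    · intro a ha
      have ha' : ∀ b, (a, b) ∉ N := fun b hb => by simp at ha; exact ha b hb
      have h1 : σ (.inl a) = .inl a := by
        rcases hb : σ (.inl a) with a' | b'
        · by_contra hne
          have hne : a ≠ a' := fun h => hne (h ▸ rfl)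
          exact hσ (.inl a) (by simp [w, hb, hne])
        · exact absurd ((hmem a b').2 hb) (ha' b')
      by_cases haM : ∃ b, (a, b) ∈ M
      · simp [h1, w, la, haM, vote, Instance.Prefers, ha']
      · push Not at haM
        simp [h1, w, la, haM, vote, Instance.Prefers, ha']
    · intro b hb
      have hb' : ∀ a, (a, b) ∉ N := fun a ha => by simp at hb; exact hb a ha
      have h1 : σ (.inr b) = .inr b := by
        obtain ⟨v, hv⟩ := σ.surjective (.inr b)
        rcases v with a | b'
        · exact absurd ((hmem a b).2 hv) (hb' a)
        · by_cases hbb : b' = b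
          · exact hbb ▸ hv
          · exact absurd (by simp [w, hv, hbb]) (hσ (.inr b'))
      by_cases hbM : ∃ a, (a, b) ∈ M
      · simp [h1, w, lb, hbM, vote, Instance.Prefers, hb']
      · push Not at hbM
        simp [h1, w, lb, hbM, vote, Instance.Prefers, hb']
  obtain ⟨u, v, huv, hsum⟩ := exists_dual_of_perm_weight_nonpos w hw
  -- both dual variables of a vertex together
  let α : A ⊕ B → ℤ := fun x => u x + v x
  have hαe : ∀ a b, (I i₀).Adj a b → wa a b + wb b ≤ α (.inl a) + α (.inr b) := by
    intro a b hab
    have h1 := huv (.inl a) (.inr b)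
    have h2 := huv (.inr b) (.inl a)
    simp only [w, hab, if_true] at h1 h2
    simp only [α]
    linarith
  have hαa : ∀ a, la a ≤ α (.inl a) := fun a => by
    have h1 := huv (.inl a) (.inl a)
    simpa only [w, if_true] using h1
  have hαb : ∀ b, lb b ≤ α (.inr b) := fun b => by
    have h1 := huv (.inr b) (.inr b)
    simpa only [w, if_true] using h1
  have hα : ∑ x, α x ≤ 0 := by
    simp only [α, Finset.sum_add_distrib]; exact hsum
  rw [sum_vertices_eq hM₀.left_unique hM₀.right_unique] at hα
  have hedge : ∀ e ∈ M, 0 ≤ α (.inl e.1) + α (.inr e.2) := by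
    rintro ⟨a, b⟩ hab
    have := hαe a b (hM₀.edge a b hab)
    have h1 : wb b = 0 := by simp [wb, show ∃ a, (a, b) ∈ M from ⟨a, hab⟩]
    have h2 : 0 ≤ wa a b := by simp only [wa, hab, if_true]; split_ifs <;> norm_num
    linarith
  have hua : ∀ a ∈ Finset.univ.filter (· ∉ M.image Prod.fst), 0 ≤ α (.inl a) := by
    intro a ha
    have ha' : ∀ b, (a, b) ∉ M := fun b hb => by simp at ha; exact ha b hb
    have := hαa a
    simpa [la, ha'] using this
  have hub : ∀ b ∈ Finset.univ.filter (· ∉ M.image Prod.snd), 0 ≤ α (.inr b) := by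
    intro b hb
    have hb' : ∀ a, (a, b) ∉ M := fun a ha => by simp at hb; exact hb a ha
    have := hαb b
    simpa [lb, hb'] using this
  have s1 := Finset.sum_nonneg hedge
  have s2 := Finset.sum_nonneg hua
  have s3 := Finset.sum_nonneg hub
  have e1 := (Finset.sum_eq_zero_iff_of_nonneg hedge).1 (by linarith)
  have e2 := (Finset.sum_eq_zero_iff_of_nonneg hua).1 (by linarith)
  have e3 := (Finset.sum_eq_zero_iff_of_nonneg hub).1 (by linarith)
  have eM : ∀ a b, (a, b) ∈ M → α (.inl a) = -α (.inr b) := fun a b hab => by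
    have := e1 (a, b) hab; simp only at this; linarith
  have eA : ∀ a, (∀ b, (a, b) ∉ M) → α (.inl a) = 0 := fun a ha => e2 a (by simpa using ha)
  have eB : ∀ b, (∀ a, (a, b) ∉ M) → α (.inr b) = 0 := fun b hb => e3 b (by simpa using hb)
  have hr : ∀ a b, (a, b) ∈ M → -1 ≤ α (.inr b) ∧ α (.inr b) ≤ 1 := by
    intro a b hab
    have h1 := hαa a
    have h2 := hαb b
    rw [eM a b hab] at h1
    simp only [la, lb, show ∃ b, (a, b) ∈ M from ⟨b, hab⟩, show ∃ a, (a, b) ∈ M from ⟨a, hab⟩,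
      if_true] at h1 h2
    constructor <;> linarith
  let d : B → ℕ := fun b => if ∃ a, (a, b) ∈ M then (1 - α (.inr b)).toNat else 2
  have hd : ∀ a b, (a, b) ∈ M → (d b : ℤ) = 1 - α (.inr b) := by
    intro a b hab
    have := hr a b hab
    simp only [d, show ∃ a, (a, b) ∈ M from ⟨a, hab⟩, if_true]
    omega
  have hd' : ∀ b, (∀ a, (a, b) ∉ M) → d b = 2 := fun b hb => by simp [d, hb]
  -- the two cases of the conditions for the edge between `a` and `b`
  have hcase : ∀ b, ((d b : ℤ) = 1 - α (.inr b) ∧ wb b = 0) ∨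
      (d b = 2 ∧ α (.inr b) = 0 ∧ wb b = 1) := by
    intro b
    by_cases hb : ∃ a, (a, b) ∈ M
    · exact .inl ⟨hd _ b hb.choose_spec, by simp [wb, hb]⟩
    · have hb' := hb
      push Not at hb'
      exact .inr ⟨hd' b hb', eB b hb', by simp [wb, hb']⟩
  refine ⟨d, fun b => ?_, hd', fun i a b b' hab hbb => ?_, fun i a b b' hab hbb => ?_,
    fun i a b ha hab => ?_⟩
  · by_cases hb : ∃ a, (a, b) ∈ M
    · obtain ⟨a, hab⟩ := hb
      have h1 := hr a b hab
      have h2 := hd a b hab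
      omega
    · push Not at hb
      exact (hd' b hb).le
  · have h1 := hαe a b' ((hadj i i₀ a b').1 hbb.1)
    have hp : pr a b' := ⟨i, fun c hc => hM₀.left_unique a _ _ hab hc ▸ hbb⟩
    have h2 : wa a b' = 1 := by simp [wa, hp]
    have h3 := hd a b hab
    have h4 := hr a b hab
    have h5 := eM a b hab
    have h6 := hcase b'
    omega
  · have h1 := hαe a b' ((hadj i i₀ a b').1 hbb.2.1)
    have h2 : -1 ≤ wa a b' := by simp only [wa]; split_ifs <;> norm_num
    have h3 := hd a b hab
    have h4 := hr a b hab
    have h5 := eM a b hab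
    have h6 := hcase b'
    omega
  · have h1 := hαe a b ((hadj i i₀ a b).1 hab)
    have hp : pr a b := ⟨i, fun c hc => absurd hc (ha c)⟩
    have h2 : wa a b = 1 := by simp [wa, hp]
    have h5 := eA a ha
    have h6 := hcase b
    have h7 : (d b : ℤ) = 1 - α (.inr b) → 0 ≤ d b := fun _ => Nat.zero_le _
    omega

end Matching

end PopularMatching

/-! ### Bipartite matchings by prices -/

namespace PopularMatching

/-- Some matching of the graph `E` covers all vertices in `P`. -/
def Saturable (P : Set ℕ) (E : ℕ → ℕ → Prop) : Prop :=
  ∃ g : ℕ → ℕ, Set.InjOn g P ∧ ∀ r ∈ P, E r (g r)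

/-- The vertices of `P` cannot be covered by a matching of `E`, because all neighbours of the set
consisting of `r` and the vertices of `T` are matched to vertices of `T`. -/
def Violates (P : Set ℕ) (E : ℕ → ℕ → Prop) (r : ℕ) : Prop :=
  r ∈ P ∧ ∃ (T : Finset ℕ) (g : ℕ → ℕ), ↑T ⊆ P ∧ r ∉ T ∧ Set.InjOn g T ∧ (∀ t ∈ T, E t (g t)) ∧
    ∀ r' ∈ insert r T, ∀ c, E r' c → ∃ t ∈ T, g t = c

theorem Violates.not_saturable {P : Set ℕ} {E : ℕ → ℕ → Prop} {r : ℕ} (h : Violates P E r) :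
    ¬ Saturable P E := by
  rintro ⟨g', hg', hE⟩
  obtain ⟨hr, T, g, hT, hrT, -, -, hN⟩ := h
  have hsub : ∀ x ∈ insert r T, x ∈ P := by
    intro x hx
    rcases Finset.mem_insert.1 hx with rfl | hx
    · exact hr
    · exact hT hx
  have h1 : (insert r T).image g' ⊆ T.image g := by
    intro c hc
    obtain ⟨x, hx, rfl⟩ := Finset.mem_image.1 hc
    obtain ⟨t, ht, htc⟩ := hN x hx _ (hE x (hsub x hx))
    exact Finset.mem_image.2 ⟨t, ht, htc⟩
  have h2 := Finset.card_le_card h1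
  rw [Finset.card_image_of_injOn (hg'.mono hsub), Finset.card_insert_of_notMem hrT] at h2
  have := Finset.card_image_le (s := T) (f := g)
  omega

/-- The state of the price method.  Every column `c < N` has a price `π c` and possibly an owner
`r`, encoded as `own c = r + 1`.  All rows in `P` own a column, except possibly one row `r`, encoded
as `cur = r + 1`.  The price of a column exceeds the prices of the other neighbours of its owner by
at most `1`. -/
structure PriceInv (E : ℕ → ℕ → Prop) (N : ℕ) (P : Set ℕ) (own π : ℕ → ℕ) (cur : ℕ) : Prop where
  owner : ∀ c < N, ∀ r, own c = r + 1 → r ∈ P ∧ E r c ∧ cur ≠ r + 1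
  unique : ∀ c < N, ∀ c' < N, own c ≠ 0 → own c = own c' → c = c'
  owned : ∀ r ∈ P, cur ≠ r + 1 → ∃ c < N, own c = r + 1
  own_ne_zero : ∀ c < N, 0 < π c → own c ≠ 0
  price : ∀ c < N, ∀ r, own c = r + 1 → ∀ c', E r c' → π c ≤ π c' + 1
  le : ∀ c < N, π c ≤ N
  cur_mem : ∀ r, cur = r + 1 → r ∈ P

namespace PriceInv

variable {E : ℕ → ℕ → Prop} {N : ℕ} {P : Set ℕ} {own π : ℕ → ℕ} {r c : ℕ}

theorem init (h : ∀ c < N, own c = 0 ∧ π c = 0) : PriceInv E N ∅ own π 0 where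
  owner c hc r hr := by simp [(h c hc).1] at hr
  unique c hc _ _ h0 _ := absurd (h c hc).1 h0
  owned r hr := hr.elim
  own_ne_zero c hc h0 := by simp [(h c hc).2] at h0
  price c hc r hr := by simp [(h c hc).1] at hr
  le c hc := by simp [(h c hc).2]
  cur_mem r hr := by simp at hr

theorem insert (h : PriceInv E N P own π 0) (hr : r ∉ P) :
    PriceInv E N (insert r P) own π (r + 1) where
  owner c hc r' hr' := by
    obtain ⟨h1, h2, -⟩ := h.owner c hc r' hr'
    refine ⟨.inr h1, h2, fun h3 => hr ?_⟩
    rwa [Nat.succ_injective h3]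
  unique := h.unique
  owned r' hr' hne := h.owned r' (hr'.resolve_left fun h => hne (h ▸ rfl)) (Nat.succ_ne_zero _).symm
  own_ne_zero := h.own_ne_zero
  price := h.price
  le := h.le
  cur_mem r' hr' := .inl (Nat.succ_injective hr').symm

theorem saturable (h : PriceInv E N P own π 0) : Saturable P E := by
  have h' : ∀ r, ∃ c, r ∈ P → c < N ∧ own c = r + 1 := fun r => by
    by_cases hr : r ∈ P
    · obtain ⟨c, hc⟩ := h.owned r hr (Nat.succ_ne_zero _).symm
      exact ⟨c, fun _ => hc⟩
    · exact ⟨0, fun h => absurd h hr⟩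
  choose g hg using h'
  refine ⟨g, fun r hr r' hr' he => ?_, fun r hr => (h.owner _ (hg r hr).1 r (hg r hr).2).2.1⟩
  have h1 := (hg r hr).2
  rw [he, (hg r' hr').2] at h1
  omega

/-- The row `r` takes over its cheapest neighbour `c`, which becomes more expensive. -/
theorem step (h : PriceInv E N P own π (r + 1)) (hc : c < N) (hE : E r c) (hπ : π c < N)
    (hmin : ∀ c', E r c' → π c ≤ π c') :
    PriceInv E N P (Function.update own c (r + 1)) (Function.update π c (π c + 1)) (own c) where
  owner c' hc' r' hr' := by
    by_cases hcc : c' = c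
    · subst hcc
      simp only [Function.update_self, Nat.add_right_cancel_iff] at hr'
      subst hr'
      refine ⟨h.cur_mem _ rfl, hE, fun h' => (h.owner _ hc _ h').2.2 rfl⟩
    · rw [Function.update_of_ne hcc] at hr'
      obtain ⟨h1, h2, -⟩ := h.owner c' hc' r' hr'
      refine ⟨h1, h2, fun h3 => hcc (h.unique c' hc' c hc (by omega) (hr'.trans h3.symm))⟩
  unique c₁ h₁ c₂ h₂ := by
    have key : ∀ c', c' < N → own c' ≠ r + 1 := fun c' hc' h' => (h.owner _ hc' _ h').2.2 rfl
    by_cases e₁ : c₁ = c <;> by_cases e₂ : c₂ = c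
    · intros; rw [e₁, e₂]
    · subst e₁
      rw [Function.update_self, Function.update_of_ne e₂]
      exact fun _ h => absurd h.symm (key _ h₂)
    · subst e₂
      rw [Function.update_self, Function.update_of_ne e₁]
      exact fun _ h => absurd h (key _ h₁)
    · rw [Function.update_of_ne e₁, Function.update_of_ne e₂]
      exact h.unique c₁ h₁ c₂ h₂
  owned r' hr' hne := by
    by_cases he : r' = r
    · exact ⟨c, hc, by rw [Function.update_self, he]⟩
    · obtain ⟨c', hc', ho⟩ := h.owned r' hr' (by omega)
      refine ⟨c', hc', ?_⟩
      rw [Function.update_of_ne, ho]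
      rintro rfl
      exact hne ho
  own_ne_zero c' hc' h0 := by
    by_cases hcc : c' = c
    · subst hcc; simp
    · rw [Function.update_of_ne hcc] at h0 ⊢
      exact h.own_ne_zero c' hc' h0
  price c' hc' r' hr' c'' hE' := by
    have hup : π c'' ≤ Function.update π c (π c + 1) c'' := by
      by_cases hcc : c'' = c
      · subst hcc; simp
      · rw [Function.update_of_ne hcc]
    by_cases hcc : c' = c
    · subst hcc
      simp only [Function.update_self, Nat.add_right_cancel_iff] at hr'
      subst hr'
      rw [Function.update_self]
      have := hmin c'' hE'
      omega
    · rw [Function.update_of_ne hcc] at hr' ⊢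
      have := h.price c' hc' r' hr' c'' hE'
      omega
  le c' hc' := by
    by_cases hcc : c' = c
    · subst hcc; simpa using hπ
    · rw [Function.update_of_ne hcc]; exact h.le c' hc'
  cur_mem r' hr' := (h.owner c hc r' hr').1

/-- If all neighbours of `r` have the maximal price `N`, then, as there are fewer than `N - 1`
columns, some price `k` with `0 < k < N` does not occur.  The columns of higher price and their
owners are the violation. -/
theorem violates (h : PriceInv E N P own π (r + 1)) (hN : 2 ≤ N)
    (hE : ∀ r c, E r c → c + 2 < N) (hmax : ∀ c, E r c → N ≤ π c) : Violates P E r := by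
  have hown : ∀ c < N, 0 < π c → ∃ r', own c = r' + 1 ∧ r' ∈ P ∧ E r' c ∧ r' ≠ r := by
    intro c hc h0
    obtain ⟨r', hr'⟩ := Nat.exists_eq_succ_of_ne_zero (h.own_ne_zero c hc h0)
    obtain ⟨h1, h2, h3⟩ := h.owner c hc r' hr'
    exact ⟨r', hr', h1, h2, fun h => h3 (h ▸ rfl)⟩
  obtain ⟨k, hk1, hkN, hk⟩ : ∃ k, 1 ≤ k ∧ k < N ∧ ∀ c < N, π c ≠ k := by
    by_contra! hcon
    have h1 : Finset.Icc 1 (N - 1) ⊆ (Finset.range (N - 2)).image π := by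
      intro k hk
      rw [Finset.mem_Icc] at hk
      obtain ⟨c, hc, hck⟩ := hcon k hk.1 (by omega)
      obtain ⟨r', -, -, hrc, -⟩ := hown c hc (by omega)
      have := hE r' c hrc
      exact Finset.mem_image.2 ⟨c, by rw [Finset.mem_range]; omega, hck⟩
    have h2 := (Finset.card_le_card h1).trans Finset.card_image_le
    rw [Nat.card_Icc, Finset.card_range] at h2
    omega
  let S := (Finset.range N).filter fun c => k < π c
  have hS : ∀ c, c ∈ S ↔ c < N ∧ k < π c := fun c => by simp [S]
  have hg : ∀ t, ∃ c, t ∈ S.image (fun c => own c - 1) → c ∈ S ∧ own c = t + 1 := by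
    intro t
    by_cases ht : t ∈ S.image (fun c => own c - 1)
    · obtain ⟨c, hc, rfl⟩ := Finset.mem_image.1 ht
      obtain ⟨r', hr', -⟩ := hown c ((hS c).1 hc).1 (by have := ((hS c).1 hc).2; omega)
      exact ⟨c, fun _ => ⟨hc, by omega⟩⟩
    · exact ⟨0, fun h => absurd h ht⟩
  choose g hg using hg
  refine ⟨h.cur_mem r rfl, S.image (fun c => own c - 1), g, ?_, ?_, ?_, ?_, ?_⟩
  · intro t ht
    exact (h.owner _ ((hS _).1 (hg t ht).1).1 t (hg t ht).2).1
  · intro ht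
    exact (h.owner _ ((hS _).1 (hg r ht).1).1 r (hg r ht).2).2.2 rfl
  · intro t ht t' ht' he
    have h1 := (hg t ht).2
    rw [he, (hg t' ht').2] at h1
    omega
  · intro t ht
    exact (h.owner _ ((hS _).1 (hg t ht).1).1 t (hg t ht).2).2.1
  · intro t ht c htc
    have hc : c < N := by have := hE t c htc; omega
    have hkc : k < π c := by
      rcases Finset.mem_insert.1 ht with rfl | ht
      · exact hkN.trans_le (hmax c htc)
      · obtain ⟨h1, h2⟩ := hg t ht
        have h3 := h.price _ ((hS _).1 h1).1 t h2 c htc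
        have h4 := ((hS _).1 h1).2
        have h5 := hk c hc
        omega
    obtain ⟨r', hr', -⟩ := hown c hc (by omega)
    have hmem : own c - 1 ∈ S.image (fun c => own c - 1) :=
      Finset.mem_image_of_mem _ ((hS c).2 ⟨hc, hkc⟩)
    obtain ⟨h1, h2⟩ := hg _ hmem
    exact ⟨_, hmem, h.unique _ ((hS _).1 h1).1 c hc (by omega) (by omega)⟩

theorem sum_le (h : PriceInv E N P own π r) : ∑ c ∈ Finset.range N, π c ≤ N * N := by
  have := Finset.sum_le_card_nsmul (Finset.range N) π N fun c hc => h.le c (Finset.mem_range.1 hc)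
  simpa using this

end PriceInv

theorem sum_update_succ {π : ℕ → ℕ} {N c : ℕ} (hc : c < N) :
    ∑ i ∈ Finset.range N, Function.update π c (π c + 1) i = ∑ i ∈ Finset.range N, π i + 1 := by
  rw [Finset.sum_update_of_mem (Finset.mem_range.2 hc), Finset.sdiff_singleton_eq_erase,
    ← Finset.add_sum_erase _ π (Finset.mem_range.2 hc)]
  ring

/-! ### Equilibria and the descending auction -/

/-- The demand of the agent `a` at the discounts `d`, where `ℓ` is a list of agents with preference
lists: `a` demands `b` if in all of her lists every better job has a smaller discount than `b`,
and the discount of every worse job exceeds that of `b` by at most `1`. -/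
def Demands (ℓ : List (ℕ × List ℕ)) (d : ℕ → ℕ) (a b : ℕ) : Prop :=
  (∃ L, (a, L) ∈ ℓ) ∧ ∀ L, (a, L) ∈ ℓ → b ∈ L ∧ ∀ b' ∈ L,
    (L.idxOf b' < L.idxOf b → d b' < d b) ∧ (L.idxOf b < L.idxOf b' → d b' ≤ d b + 1)

section Auction

variable {ℓ : List (ℕ × List ℕ)} {d α : ℕ → ℕ} {a b c : ℕ}

/-- Raising the discounts of other jobs does not increase the demand for a job. -/
theorem Demands.of_le (h : Demands ℓ α a b) (hd : ∀ x, d x ≤ α x) (hb : d b = α b) :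
    Demands ℓ d a b := by
  refine ⟨h.1, fun L hL => ⟨(h.2 L hL).1, fun b' hb' => ?_⟩⟩
  have h1 := (h.2 L hL).2 b' hb'
  have h2 := hd b'
  exact ⟨fun h => by have := h1.1 h; omega, fun h => by have := h1.2 h; omega⟩

/-- Of two jobs in demand, neither remains in demand if only the other one becomes cheaper. -/
theorem Demands.not_of_lt (hb : Demands ℓ d a b) (hc : Demands ℓ d a c) (hne : b ≠ c)
    (hdb : d b = α b) (hdc : d c < α c) : ¬ Demands ℓ α a b := by
  intro h
  obtain ⟨L, hL⟩ := hb.1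
  have hbL := (hb.2 L hL).1
  have hcL := (hc.2 L hL).1
  have h1 := (hc.2 L hL).2 b hbL
  have h2 := (h.2 L hL).2 c hcL
  rcases lt_trichotomy (L.idxOf b) (L.idxOf c) with hlt | heq | hlt
  · have := h1.1 hlt
    have := h2.2 hlt
    omega
  · exact hne ((List.idxOf_inj hbL).1 heq)
  · have := h1.2 hlt
    have := h2.1 hlt
    omega

/-- An equilibrium of the market with the agents `a < nA`, the jobs `b < nB` and, for every agent
`a`, a last resort `nB + a` of fixed discount `1`: every agent `a` gets a job `f a` that she
demands, and all jobs of discount at most `1` are taken. -/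
structure IsEquilibrium (ℓ : List (ℕ × List ℕ)) (nA nB : ℕ) (α f : ℕ → ℕ) : Prop where
  le_two : ∀ b < nB, α b ≤ 2
  last : ∀ a < nA, α (nB + a) = 1
  inj : Set.InjOn f (Set.Iio nA)
  demands : ∀ a < nA, Demands ℓ α a (f a)
  cover : ∀ b < nB, α b ≤ 1 → ∃ a < nA, f a = b

variable {nA nB : ℕ} {f : ℕ → ℕ}

/-- The jobs that have to be matched at the discounts `d`. -/
def Tight (nB : ℕ) (d : ℕ → ℕ) : Set ℕ := {b | b < nB ∧ d b ≤ 1}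

/-- If the jobs of discount at most `1` cannot all be matched, then the uncovered job has a higher
discount in every equilibrium above `d`. -/
theorem IsEquilibrium.lt_of_violates (h : IsEquilibrium ℓ nA nB α f) (hd : ∀ x, d x ≤ α x)
    (hv : Violates (Tight nB d) (fun b a => Demands ℓ d a b) b) :
    d b < α b := by
  classical
  obtain ⟨hbP, T, g, hT, hbT, hg, hgE, hN⟩ := hv
  by_contra hlt
  have hb : d b = α b := le_antisymm (hd b) (not_lt.1 hlt)
  let T₁ := T.filter fun t => d t = α t
  let R := T.filter fun t => ¬ d t = α t
  have hsub : ∀ x ∈ insert b T₁, x ∈ insert b T ∧ d x = α x := by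
    intro x hx
    rcases Finset.mem_insert.1 hx with rfl | hx
    · exact ⟨Finset.mem_insert_self _ _, hb⟩
    · exact ⟨Finset.mem_insert_of_mem (Finset.mem_filter.1 hx).1, (Finset.mem_filter.1 hx).2⟩
  -- the partner in the equilibrium of a job whose discount is the same
  have hp : ∀ x, ∃ a, x ∈ insert b T₁ → f a = x ∧ Demands ℓ α a x := by
    intro x
    by_cases hx : x ∈ insert b T₁
    · have hxP : x ∈ Tight nB d := by
        rcases Finset.mem_insert.1 (hsub x hx).1 with rfl | hx
        · exact hbP
        · exact hT hx
      obtain ⟨a, ha, rfl⟩ := h.cover x hxP.1 ((hsub x hx).2 ▸ hxP.2)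
      exact ⟨a, fun _ => ⟨rfl, h.demands a ha⟩⟩
    · exact ⟨0, fun h => absurd h hx⟩
  choose p hp using hp
  have hmap : (insert b T₁).image p ⊆ T.image g \ R.image g := by
    intro a ha
    obtain ⟨x, hx, rfl⟩ := Finset.mem_image.1 ha
    obtain ⟨-, hdem⟩ := hp x hx
    obtain ⟨hxT, hdx⟩ := hsub x hx
    have hdem' := hdem.of_le hd hdx
    obtain ⟨t, ht, hta⟩ := hN x hxT _ hdem'
    refine Finset.mem_sdiff.2 ⟨Finset.mem_image.2 ⟨t, ht, hta⟩, fun hR => ?_⟩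
    obtain ⟨c, hc, hca⟩ := Finset.mem_image.1 hR
    obtain ⟨hcT, hcne⟩ := Finset.mem_filter.1 hc
    have hcE := hgE c hcT
    rw [hca] at hcE
    have hne : x ≠ c := fun h => hcne (h ▸ hdx)
    exact hdem'.not_of_lt hcE hne hdx (lt_of_le_of_ne (hd c) hcne) hdem
  have hpinj : Set.InjOn p (insert b T₁ : Finset ℕ) := by
    intro x hx y hy he
    rw [← (hp x hx).1, ← (hp y hy).1, he]
  have h1 := Finset.card_le_card hmap
  have hbT₁ : b ∉ T₁ := fun h => hbT (Finset.mem_filter.1 h).1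
  have hRT : R ⊆ T := Finset.filter_subset _ _
  rw [Finset.card_image_of_injOn hpinj, Finset.card_insert_of_notMem hbT₁,
    Finset.card_sdiff_of_subset (Finset.image_subset_image hRT), Finset.card_image_of_injOn hg,
    Finset.card_image_of_injOn (hg.mono hRT)] at h1
  have h2 : T₁.card + R.card = T.card :=
    Finset.card_filter_add_card_filter_not (s := T) fun t => d t = α t
  omega

/-- If the jobs of discount at most `1` can all be matched at the discounts `d`, and there is an
equilibrium above `d`, then all agents can be matched at the discounts `d`: the agents
who get a job of raised discount in the equilibrium are matched as at `d`, the other ones as in the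
equilibrium. -/
theorem IsEquilibrium.saturable_agents (h : IsEquilibrium ℓ nA nB α f) (hd : ∀ x, d x ≤ α x)
    (hlast : ∀ a < nA, d (nB + a) = 1)
    (hℓ : ∀ a L, (a, L) ∈ ℓ → a < nA ∧ ∀ b ∈ L, b < nB ∨ b = nB + a)
    (hs : Saturable (Tight nB d) fun b a => Demands ℓ d a b) :
    Saturable (Set.Iio nA) (Demands ℓ d) := by
  classical
  obtain ⟨n, hn, hnE⟩ := hs
  have hlt : ∀ a b, Demands ℓ d a b → a < nA := fun a b hab => by
    obtain ⟨L, hL⟩ := hab.1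
    exact (hℓ a L hL).1
  let R := (Finset.range nB).filter fun b => d b < α b
  have hR : ∀ b, b ∈ R ↔ b < nB ∧ d b < α b := fun b => by simp [R]
  have hRP : ∀ b ∈ R, b ∈ Tight nB d := fun b hb => by
    have h1 := (hR b).1 hb
    have := h.le_two b h1.1
    exact ⟨h1.1, by omega⟩
  -- jobs of equal discount are outside of `R`
  have heq : ∀ a < nA, f a ∉ R → d (f a) = α (f a) := by
    intro a ha hfa
    obtain ⟨L, hL⟩ := (h.demands a ha).1
    rcases (hℓ a L hL).2 _ ((h.demands a ha).2 L hL).1 with hlt | he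
    · by_contra hne
      exact hfa ((hR _).2 ⟨hlt, lt_of_le_of_ne (hd _) hne⟩)
    · rw [he, hlast a ha, h.last a ha]
  have hmap : ∀ b ∈ R, f (n b) ∈ R := by
    intro b hb
    by_contra hfb
    have hnb := hnE b (hRP b hb)
    have ha := hlt _ _ hnb
    have hdf := heq _ ha hfb
    have hdem := h.demands _ ha
    exact (hdem.of_le hd hdf).not_of_lt hnb (fun h => hfb (by rw [h]; exact hb)) hdf ((hR b).1 hb).2 hdem
  have hinj : Set.InjOn (fun b => f (n b)) R := by
    intro b hb b' hb' he
    exact hn (hRP b hb) (hRP b' hb')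
      (h.inj (hlt _ _ (hnE b (hRP b hb))) (hlt _ _ (hnE b' (hRP b' hb'))) he)
  have himg : R.image (fun b => f (n b)) = R :=
    Finset.eq_of_subset_of_card_le
      (Finset.image_subset_iff.2 hmap) (Finset.card_image_of_injOn hinj).ge
  -- the agents who get a job in `R` in the equilibrium are the partners of `R` at `d`
  have hq : ∀ a, ∃ b, a < nA → f a ∈ R → b ∈ R ∧ n b = a := by
    intro a
    by_cases ha : a < nA ∧ f a ∈ R
    · rw [← himg] at ha
      obtain ⟨b, hb, hba⟩ := Finset.mem_image.1 ha.2
      exact ⟨b, fun _ _ => ⟨hb, h.inj (hlt _ _ (hnE b (hRP b hb))) ha.1 hba⟩⟩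
    · exact ⟨0, fun h1 h2 => absurd ⟨h1, h2⟩ ha⟩
  choose q hq using hq
  refine ⟨fun a => if f a ∈ R then q a else f a, ?_, ?_⟩
  · intro a ha a' ha' he
    simp only at he
    split_ifs at he with h1 h2 h2
    · rw [← (hq a ha h1).2, ← (hq a' ha' h2).2, he]
    · exact absurd (he ▸ (hq a ha h1).1) h2
    · exact absurd (he ▸ (hq a' ha' h2).1) h1
    · exact h.inj ha ha' he
  · intro a ha
    dsimp only
    split_ifs with h1
    · obtain ⟨h2, h3⟩ := hq a ha h1
      have := hnE _ (hRP _ h2)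
      rwa [h3] at this
    · exact (h.demands a ha).of_le hd (heq a ha h1)

/-- The agents to be matched as in `f` when a matching `f` of the agents is combined with a
matching `n` of the jobs in `P`. -/
inductive KeepsPartner (nA : ℕ) (P : Set ℕ) (f n : ℕ → ℕ) : ℕ → Prop
  | start {a : ℕ} : a < nA → (∀ b ∈ P, n b ≠ a) → KeepsPartner nA P f n a
  | next {a : ℕ} : KeepsPartner nA P f n a → f a ∈ P → KeepsPartner nA P f n (n (f a))

/-- If the agents can be matched, and the jobs in `P` can be matched, then some matching covers the
agents and `P` (Mendelsohn and Dulmage). -/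
theorem exists_matching_of_saturable {P : Set ℕ} {E : ℕ → ℕ → Prop}
    (hE : ∀ a b, E a b → a < nA)
    (hA : Saturable (Set.Iio nA) E) (hP : Saturable P fun b a => E a b) :
    ∃ f, Set.InjOn f (Set.Iio nA) ∧ (∀ a < nA, E a (f a)) ∧ ∀ b ∈ P, ∃ a < nA, f a = b := by
  classical
  obtain ⟨f, hf, hfE⟩ := hA
  obtain ⟨n, hn, hnE⟩ := hP
  let K := KeepsPartner nA P f n
  have hKlt : ∀ a, K a → a < nA := by
    intro a ha
    induction ha with
    | start h _ => exact h
    | next _ h _ => exact hE _ _ (hnE _ h)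
  have hq : ∀ a, ∃ b, a < nA → ¬ K a → b ∈ P ∧ n b = a := by
    intro a
    by_cases ha : a < nA ∧ ¬ K a
    · by_contra! hcon
      exact ha.2 (.start ha.1 fun b hb => (hcon b).2.2 hb)
    · exact ⟨0, fun h1 h2 => absurd ⟨h1, h2⟩ ha⟩
  choose q hq using hq
  have hmix : ∀ a a', K a → a' < nA → ¬ K a' → f a ≠ q a' := by
    intro a a' ha ha' hna he
    obtain ⟨h1, h2⟩ := hq a' ha' hna
    exact hna (h2 ▸ he ▸ .next ha (he ▸ h1))
  refine ⟨fun a => if K a then f a else q a, ?_, ?_, ?_⟩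
  · intro a ha a' ha' he
    simp only at he
    split_ifs at he with h1 h2 h2
    · exact hf ha ha' he
    · exact absurd he (hmix a a' h1 ha' h2)
    · exact absurd he.symm (hmix a' a h2 ha h1)
    · rw [← (hq a ha h1).2, ← (hq a' ha' h2).2, he]
  · intro a ha
    dsimp only
    split_ifs with h1
    · exact hfE a ha
    · obtain ⟨h2, h3⟩ := hq a ha h1
      have := hnE _ h2
      rwa [h3] at this
  · intro b hb
    by_cases hK : K (n b)
    · generalize hna : n b = a at hK
      cases hK with
      | start _ h => exact absurd hna (h b hb)
      | @next a' h h' =>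
        refine ⟨a', hKlt _ h, ?_⟩
        dsimp only
        rw [if_pos (show K a' from h)]
        exact hn h' hb hna.symm
    · have hlt := hE _ _ (hnE b hb)
      refine ⟨n b, hlt, ?_⟩
      dsimp only
      rw [if_neg hK]
      obtain ⟨h1, h2⟩ := hq _ hlt hK
      exact hn h1 hb h2

/-- The invariant of the auction: the discounts `d` are at most those of any equilibrium. -/
structure IsLowerBound (ℓ : List (ℕ × List ℕ)) (nA nB : ℕ) (d : ℕ → ℕ) : Prop where
  le_two : ∀ b < nB, d b ≤ 2
  last : ∀ a < nA, d (nB + a) = 1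
  le : ∀ α f, IsEquilibrium ℓ nA nB α f → ∀ x, d x ≤ α x

theorem IsLowerBound.update (h : IsLowerBound ℓ nA nB d)
    (hv : Violates (Tight nB d) (fun b a => Demands ℓ d a b) b) :
    IsLowerBound ℓ nA nB (Function.update d b (d b + 1)) where
  le_two b' hb' := by
    by_cases hbb : b' = b
    · subst hbb
      have := hv.1.2
      simp only [Function.update_self]; omega
    · rw [Function.update_of_ne hbb]; exact h.le_two b' hb'
  last a ha := by
    have := hv.1.1
    rw [Function.update_of_ne (by omega)]; exact h.last a ha
  le α f hα x := by
    by_cases hxb : x = b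
    · subst hxb
      simpa using hα.lt_of_violates (h.le α f hα) hv
    · rw [Function.update_of_ne hxb]; exact h.le α f hα x

theorem IsLowerBound.saturable_agents_iff (h : IsLowerBound ℓ nA nB d)
    (hℓ : ∀ a L, (a, L) ∈ ℓ → a < nA ∧ ∀ b ∈ L, b < nB ∨ b = nB + a)
    (hs : Saturable (Tight nB d) fun b a => Demands ℓ d a b) :
    Saturable (Set.Iio nA) (Demands ℓ d) ↔ ∃ α f, IsEquilibrium ℓ nA nB α f := by
  constructor
  · intro hA
    obtain ⟨f, h1, h2, h3⟩ := exists_matching_of_saturable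
      (fun a b hab => hab.1.elim fun L hL => (hℓ a L hL).1) hA hs
    exact ⟨d, f, h.le_two, h.last, h1, h2, fun b hb hdb => h3 b ⟨hb, hdb⟩⟩
  · rintro ⟨α, f, hα⟩
    exact hα.saturable_agents (h.le α f hα) h.last hℓ hs

end Auction

end PopularMatching

/-! ### The program for bipartite matchings

All programs use the same memory layout.  The variable `1` holds the number one, the variables `2`,
`3` and `4` the numbers of agents, jobs and instances, the variable `5` the number of entries of all
preference lists, and the variable `6` a number that exceeds the number of agents, jobs and last
resorts by `2`.  The variable `8` reports violations, and the other ones are local.  The array `0`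
holds the input, and the arrays `1`, `2` and `3` the groups, agents and jobs of the entries.  The
array `4` is zero, the array `5` holds the discounts, the array `6` marks the entries in demand, and
the arrays `7` and `8` hold owners and prices. -/

namespace PopularMatching

open RandomAccess RandomAccess.Program

theorem Violates.mono {P P' : Set ℕ} {E : ℕ → ℕ → Prop} {r : ℕ} (h : Violates P E r)
    (hP : P ⊆ P') : Violates P' E r := by
  obtain ⟨hr, T, g, hT, h'⟩ := h
  exact ⟨hP hr, T, g, hT.trans hP, h'⟩

/-- One step of the search for the cheapest neighbour of the row in the variable `13`: the entry
given by the variable `10` is compared to the price in the variable `11` of the column in the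
variable `12`, shifted by one.  The entries connect the rows in the array `R` to the columns in the
array `C`, provided that they are marked in the array `6`.  The array `8` holds the prices. -/
def scanEntry (R C : ℕ) : Program :=
  block [.load 14 6 10, .cond 14 (block [.load 15 R 10, .sub 16 15 13, .sub 17 13 15, .add 16 16 17,
    .cond 16 .skip (block [.load 15 C 10, .load 16 8 15, .sub 17 11 16,
      .cond 17 (block [.copy 11 16, .add 12 15 1]) .skip])]) .skip]

/-- One step of the price method.  The variable `9` holds the row without a column, the array `7`
the owners of the columns, all shifted by one.  If all columns are too expensive, the row is
reported in the variable `8`. -/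
def priceStep (R C : ℕ) : Program :=
  block [.copy 11 6, .const 12 0, .sub 13 9 1, countdown 10 5 (scanEntry R C),
    .cond 12
      (block [.sub 14 12 1, .load 15 7 14, .store 7 14 9, .add 11 11 1, .store 8 14 11, .copy 9 15])
      (block [.copy 8 9, .const 9 0])]

/-- Searches for a matching that covers all rows smaller than the variable `cnt` whose entry in the
array `D` is at most `1`.  If there is none, a violating row, shifted by one, is stored in the
variable `8`, and otherwise zero. -/
def matchRows (R C D cnt : ℕ) : Program :=
  block [.const 8 0, .const 11 0, countdown 10 6 (block [.store 7 10 11, .store 8 10 11]),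
    countdown 7 cnt (.cond 8 .skip (block [.load 10 D 7, .sub 10 10 1,
      .cond 10 .skip (block [.add 9 7 1, .loop 9 (priceStep R C)])]))]

/-- The graph given by the first `m` entries of the rows `R`, columns `C` and marks `ok`. -/
def EntryGraph (m : ℕ) (ok R C : ℕ → ℕ) (r c : ℕ) : Prop :=
  ∃ t < m, ok t ≠ 0 ∧ R t = r ∧ C t = c

theorem haltsWithin_scan {R C : ℕ} {s : State} (h1 : s.var 1 = 1) (hbest : s.var 11 = s.var 6)
    (hcol : s.var 12 = 0) :
    HaltsWithin (countdown 10 5 (scanEntry R C)) (s.var 5 * 22 + 2) s fun s' =>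
      (s'.var 12 = 0 ∧ ∀ c, EntryGraph (s.var 5) (s.arr 6) (s.arr R) (s.arr C) (s.var 13) c →
        s.var 6 ≤ s.arr 8 c) ∨
      ∃ c, s'.var 12 = c + 1 ∧ s'.var 11 = s.arr 8 c ∧ s.arr 8 c < s.var 6 ∧
        EntryGraph (s.var 5) (s.arr 6) (s.arr R) (s.arr C) (s.var 13) c ∧
        ∀ c', EntryGraph (s.var 5) (s.arr 6) (s.arr R) (s.arr C) (s.var 13) c' →
          s.arr 8 c ≤ s.arr 8 c' := by
  let Inv : ℕ → State → Prop := fun i s₁ =>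
    (∀ t, i ≤ t → t < s.var 5 → s.arr 6 t ≠ 0 → s.arr R t = s.var 13 →
      s₁.var 11 ≤ s.arr 8 (s.arr C t)) ∧
    ((s₁.var 12 = 0 ∧ s₁.var 11 = s.var 6) ∨
      ∃ c, s₁.var 12 = c + 1 ∧ s₁.var 11 = s.arr 8 c ∧ s.arr 8 c < s.var 6 ∧
        EntryGraph (s.var 5) (s.arr 6) (s.arr R) (s.arr C) (s.var 13) c)
  refine (HaltsWithin.countdown Inv (T := 20) (by simp [scanEntry]) (by simp)
    (by simp [scanEntry]) h1 ?_ ?_ ?_).mono (by omega) ?_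
  · intro i s₁ v h
    simpa [Inv] using h
  · intro i hi s₁ hF hx hI
    refine .of_loopFree (by simp [scanEntry]) (by simp [scanEntry]) ?_
    have v1 : s₁.var 1 = 1 :=
      (hF.var 1 (by simp [scanEntry])).trans h1
    have v13 : s₁.var 13 = s.var 13 :=
      hF.var 13 (by simp [scanEntry])
    have ha : s₁.arr = s.arr := funext fun r =>
      hF.arr r (by simp [scanEntry])
    obtain ⟨hI1, hI2⟩ := hI
    have hle : s₁.var 11 ≤ s.var 6 := by
      rcases hI2 with h | ⟨c, -, h, h', -⟩ <;> omega
    by_cases hok : s.arr 6 i = 0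
    · have : (scanEntry R C).eval s₁ = s₁.setVar 14 0 := by
        simp [scanEntry, hx, ha, hok]
      rw [this]
      refine ⟨fun t ht htm h0 hR => ?_, by simpa using hI2⟩
      rcases ht.eq_or_lt with rfl | ht
      · exact absurd hok h0
      · simpa using hI1 t ht htm h0 hR
    by_cases hR : s.arr R i = s.var 13
    · by_cases hbe : s₁.var 11 ≤ s.arr 8 (s.arr C i)
      · have e11 : ((scanEntry R C).eval s₁).var 11 = s₁.var 11 := by
          simp [scanEntry, hx, ha, hok, hR, v13, hbe]
        have e12 : ((scanEntry R C).eval s₁).var 12 = s₁.var 12 := by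
          simp [scanEntry, hx, ha, hok, hR, v13, hbe]
        refine ⟨fun t ht htm h0 hR => ?_, by rwa [e11, e12]⟩
        rw [e11]
        rcases ht.eq_or_lt with rfl | ht
        · exact hbe
        · exact hI1 t ht htm h0 hR
      · have e11 : ((scanEntry R C).eval s₁).var 11 = s.arr 8 (s.arr C i) := by
          simp [scanEntry, hx, ha, hok, hR, v13, hbe, Nat.sub_eq_zero_iff_le]
        have e12 : ((scanEntry R C).eval s₁).var 12 = s.arr C i + 1 := by
          simp [scanEntry, hx, ha, hok, hR, v13, hbe, v1, Nat.sub_eq_zero_iff_le]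
        refine ⟨fun t ht htm h0 hR => ?_, .inr ⟨_, e12, e11, by omega, i, hi, hok, hR, rfl⟩⟩
        rw [e11]
        rcases ht.eq_or_lt with rfl | ht
        · rfl
        · exact le_trans (by omega) (hI1 t ht htm h0 hR)
    · have hR' : ¬ (s.arr R i ≤ s.var 13 ∧ s.var 13 ≤ s.arr R i) := fun h => hR (le_antisymm h.1 h.2)
      have e11 : ((scanEntry R C).eval s₁).var 11 = s₁.var 11 := by
        simp [scanEntry, hx, ha, hok, hR', v13, Nat.sub_eq_zero_iff_le]
      have e12 : ((scanEntry R C).eval s₁).var 12 = s₁.var 12 := by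
        simp [scanEntry, hx, ha, hok, hR', v13, Nat.sub_eq_zero_iff_le]
      refine ⟨fun t ht htm h0 hRt => ?_, by rwa [e11, e12]⟩
      rw [e11]
      rcases ht.eq_or_lt with rfl | ht
      · exact absurd hRt hR
      · exact hI1 t ht htm h0 hRt
  · exact ⟨fun t ht htm => absurd ht (by omega), .inl ⟨hcol, hbest⟩⟩
  · rintro s' ⟨hI1, hI2⟩
    rcases hI2 with ⟨h12, h11⟩ | ⟨c, h12, h11, hlt, hE⟩
    · refine .inl ⟨h12, ?_⟩
      rintro c ⟨t, ht, h0, hR, rfl⟩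
      exact h11 ▸ hI1 t (Nat.zero_le _) ht h0 hR
    · refine .inr ⟨c, h12, h11, hlt, hE, ?_⟩
      rintro c' ⟨t, ht, h0, hR, rfl⟩
      exact h11 ▸ hI1 t (Nat.zero_le _) ht h0 hR

theorem haltsWithin_priceStep {R C m N r : ℕ} {P : Set ℕ} {ok ρ γ : ℕ → ℕ} {s : State}
    (h1 : s.var 1 = 1) (h5 : s.var 5 = m) (h6 : s.var 6 = N) (h8 : s.var 8 = 0)
    (hok : s.arr 6 = ok) (hR : s.arr R = ρ) (hC : s.arr C = γ) (hN : 2 ≤ N)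
    (hE : ∀ r c, EntryGraph m ok ρ γ r c → c + 2 < N) (h9 : s.var 9 = r + 1)
    (hI : PriceInv (EntryGraph m ok ρ γ) N P (s.arr 7) (s.arr 8) (s.var 9)) :
    HaltsWithin (priceStep R C) (m * 22 + 20) s fun s' =>
      (s'.var 8 = 0 ∧ PriceInv (EntryGraph m ok ρ γ) N P (s'.arr 7) (s'.arr 8) (s'.var 9) ∧
        ∑ c ∈ Finset.range N, s'.arr 8 c = ∑ c ∈ Finset.range N, s.arr 8 c + 1) ∨
      (s'.var 9 = 0 ∧ ∃ r, s'.var 8 = r + 1 ∧ Violates P (EntryGraph m ok ρ γ) r) := by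
  subst m ok ρ γ
  refine HaltsWithin.mono (T₁ := s.var 5 * 22 + 2 + 13 + 1 + 1 + 1) ?_ (by omega) fun _ h => h
  refine .cons_step (by simp) (by simp) (.cons_step (by simp) (by simp)
    (.cons_step (by simp) (by simp) ?_))
  refine .cons (T₁ := s.var 5 * 22 + 2) (T₂ := 13)
    (HaltsWithin.imp (haltsWithin_scan (by simp [h1]) (by simp) (by simp)) (by simp)
      fun s' hF h => And.intro hF h) ?_
  rintro s₁ - ⟨hF, h⟩
  refine .of_loopFree (by simp) (by simp) ?_
  have ha : s₁.arr = s.arr := funext fun r => by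
    simpa using hF.arr r (by simp [scanEntry])
  have v1 : s₁.var 1 = 1 := by simpa [h1] using hF.var 1 (by simp [scanEntry])
  have v8 : s₁.var 8 = 0 := by simpa [h8] using hF.var 8 (by simp [scanEntry])
  have v9 : s₁.var 9 = r + 1 := by simpa [h9] using hF.var 9 (by simp [scanEntry])
  simp only [eval, State.setVar, Function.update_self, h6, h9, h1, Function.update_apply] at h
  simp only [Nat.reduceEqDiff, if_false, Nat.add_sub_cancel] at h
  rw [h9] at hI
  rcases h with ⟨h12, hmax⟩ | ⟨c, h12, h11, hlt, hedge, hmin⟩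
  · right
    simp [h12, v9]
    exact hI.violates hN hE hmax
  · left
    have hc : c < N := by have := hE _ _ hedge; omega
    simp [h12, h11, v1, v8, v9, ha]
    refine ⟨hI.step hc hedge hlt hmin, sum_update_succ hc⟩

theorem haltsWithin_matchRows {R C D cnt m N : ℕ} {ok ρ γ δ : ℕ → ℕ} {s : State}
    (h1 : s.var 1 = 1) (h5 : s.var 5 = m) (h6 : s.var 6 = N)
    (hok : s.arr 6 = ok) (hR : s.arr R = ρ) (hC : s.arr C = γ) (hD : s.arr D = δ)
    (hcnt : cnt < 7) (hR7 : R < 7) (hC7 : C < 7) (hD7 : D < 7) (hN : 2 ≤ N)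
    (hE : ∀ r c, EntryGraph m ok ρ γ r c → c + 2 < N) :
    HaltsWithin (matchRows R C D cnt)
      (N * 5 + 2 + (s.var cnt * ((N * N + 1) * (m * 22 + 21) + 12) + 6)) s fun s' =>
      (s'.var 8 = 0 ∧ Saturable {r | r < s.var cnt ∧ δ r ≤ 1} (EntryGraph m ok ρ γ)) ∨
      ∃ r, s'.var 8 = r + 1 ∧ Violates {r | r < s.var cnt ∧ δ r ≤ 1} (EntryGraph m ok ρ γ) r := by
  obtain ⟨K, hK⟩ : ∃ K, (N * N + 1) * (m * 22 + 21) = K := ⟨_, rfl⟩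
  rw [hK]
  refine HaltsWithin.mono (T₁ := N * 5 + 2 +
    ((s.var cnt * (K + 12) + 2) + (0 + 1)) + 1 + 1) ?_ (by omega)
    fun _ h => h
  refine .cons_step (by simp) (by simp) (.cons_step (by simp) (by simp) ?_)
  -- all columns become free
  refine .cons (R := fun s₁ => ∀ c < N, s₁.arr 7 c = 0 ∧ s₁.arr 8 c = 0) ?_ ?_
  · have := HaltsWithin.countdown (x := 10) (n := 6)
      (s := (Program.const 11 0).eval ((Program.const 8 0).eval s)) (T := 3)
      (p := block [.store 7 10 11, .store 8 10 11])
      (Inv := fun i s₁ => ∀ c, i ≤ c → c < N → s₁.arr 7 c = 0 ∧ s₁.arr 8 c = 0)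
      (by simp) (by simp) (by simp) (by simp [h1]) (by intro i s₁ v h; simpa using h)
      (by
        intro i hi s₁ hF hx hI
        refine .of_loopFree (by simp) (by simp) ?_
        have h11 : s₁.var 11 = 0 := by simpa using hF.var 11 (by simp)
        intro c hc hcN
        rcases hc.eq_or_lt with rfl | hc
        · simp [hx, h11]
        · have := hI c hc hcN
          simpa [hx, h11, hc.ne', Function.update_apply] using this)
      (by simp [h6]; intros; omega)
    refine this.mono (by simp [h6]) fun s' h c hc => h c (Nat.zero_le _) hc
  intro s₁ hF hfree
  have w1 : s₁.var 1 = 1 := by simpa [h1] using hF.var 1 (by simp)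
  have w5 : s₁.var 5 = m := by simpa [h5] using hF.var 5 (by simp)
  have w6 : s₁.var 6 = N := by simpa [h6] using hF.var 6 (by simp)
  have w8 : s₁.var 8 = 0 := by simpa using hF.var 8 (by simp)
  have wcnt : s₁.var cnt = s.var cnt := by
    have h8 : cnt ≠ 8 := by omega
    have h11 : cnt ≠ 11 := by omega
    simpa [h8, h11] using hF.var cnt (by simp; omega)
  have warr : ∀ r < 7, s₁.arr r = s.arr r := fun r hr => by
    simpa using hF.arr r (by simp; omega)
  let P : ℕ → Set ℕ := fun i => {r | i ≤ r ∧ r < s.var cnt ∧ δ r ≤ 1}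
  have hP : {r | r < s.var cnt ∧ δ r ≤ 1} = P 0 := by ext; simp [P]
  let E := EntryGraph m ok ρ γ
  refine .cons (R := fun s₂ => (s₂.var 8 = 0 ∧ Saturable (P 0) E) ∨
    ∃ r, s₂.var 8 = r + 1 ∧ Violates (P 0) E r) ?_ fun s₂ _ h => .nil (by rwa [hP])
  rw [← wcnt]
  let Inv : ℕ → State → Prop := fun i s₂ =>
    (s₂.var 8 = 0 ∧ PriceInv E N (P i) (s₂.arr 7) (s₂.arr 8) 0) ∨
      ∃ r, s₂.var 8 = r + 1 ∧ Violates (P i) E r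
  have hmono : ∀ i, P (i + 1) ⊆ P i := fun i r hr => ⟨by have := hr.1; omega, hr.2⟩
  refine (HaltsWithin.countdown Inv (T := K + 10)
    (by simp [priceStep, scanEntry]) (by simp) (by simp [priceStep, scanEntry])
    w1 ?_ ?_ ?_).mono le_rfl ?_
  · intro i s₂ v h
    simpa [Inv] using h
  · intro i hi s₂ hF₂ hx hI
    rw [wcnt] at hi
    have x1 : s₂.var 1 = 1 := (hF₂.var 1 (by simp [priceStep, scanEntry])).trans w1
    have x5 : s₂.var 5 = m := (hF₂.var 5 (by simp [priceStep, scanEntry])).trans w5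
    have x6 : s₂.var 6 = N := (hF₂.var 6 (by simp [priceStep, scanEntry])).trans w6
    have xarr : ∀ r < 7, s₂.arr r = s.arr r := fun r hr =>
      (hF₂.arr r (by simp [priceStep, scanEntry]; omega)).trans (warr r hr)
    refine HaltsWithin.mono (T₁ := K + 9 + 1) ?_ (by omega)
      fun _ h => h
    refine .cond (fun h8 => .of_loopFree (by simp) (by simp) ?_) fun h8 => ?_
    · obtain ⟨r, hr, hv⟩ := hI.resolve_left fun h => h8 h.1
      exact .inr ⟨r, hr, hv.mono (hmono i)⟩
    have hI := (hI.resolve_right fun ⟨r, hr, _⟩ => by omega).2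
    refine HaltsWithin.mono (T₁ := K + 4 + 1 + (0 + 1) + 1 + 1) ?_
      (by omega) fun _ h => h
    refine .cons_step (by simp) (by simp) (.cons_step (by simp) (by simp) ?_)
    refine .cons (T₁ := K + 4 + 1) (T₂ := 0 + 1) (R := Inv i)
      (.cond (fun ha => .of_loopFree (by simp) (by simp) ?_) fun ha => ?_)
      fun s₃ _ h => .nil h
    · have hδ : ¬ δ i ≤ 1 := by
        simp [hx, x1, xarr D hD7, hD] at ha
        omega
      have hPi : P i = P (i + 1) := by
        refine Set.Subset.antisymm (fun r hr => ⟨?_, hr.2⟩) (hmono i)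
        rcases hr.1.eq_or_lt with rfl | hlt
        · exact absurd hr.2.2 hδ
        · exact hlt
      left
      simpa [hPi, h8] using hI
    · have hδ : δ i ≤ 1 := by
        simp [hx, x1, xarr D hD7, hD] at ha
        omega
      have hPi : P i = insert i (P (i + 1)) := by
        ext r
        constructor
        · rintro hr
          rcases hr.1.eq_or_lt with rfl | hlt
          · exact .inl rfl
          · exact .inr ⟨hlt, hr.2⟩
        · rintro (rfl | hr)
          · exact ⟨le_rfl, hi, hδ⟩
          · exact hmono i hr
      refine HaltsWithin.mono (T₁ := K + 1 + (0 + 1) + 1) ?_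
        (by omega) fun _ h => h
      refine .cons_step (by simp) (by simp) ?_
      refine .cons (T₁ := K + 1) (T₂ := 0 + 1) (R := Inv i) ?_ fun s₃ _ h => .nil h
      set s₃ := (Program.add 9 7 1).eval ((Program.sub 10 10 1).eval
        ((Program.load 10 D 7).eval s₂)) with hs₃
      have y8 : s₃.var 8 = 0 := by simp [hs₃, h8]
      have y9 : s₃.var 9 = i + 1 := by simp [hs₃, hx, x1]
      have y1 : s₃.var 1 = 1 := by simp [hs₃, x1]
      have y5 : s₃.var 5 = m := by simp [hs₃, x5]
      have y6 : s₃.var 6 = N := by simp [hs₃, x6]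
      have yarr : s₃.arr = s₂.arr := by simp [hs₃]
      have hI₃ : PriceInv E N (P i) (s₃.arr 7) (s₃.arr 8) (s₃.var 9) := by
        rw [y9, yarr, hPi]
        exact hI.insert fun h => by have := h.1; omega
      -- the sum of the prices bounds the number of steps
      refine (HaltsWithin.loop (x := 9) (T := m * 22 + 20) (p := priceStep R C)
        (Inv := fun s₄ =>
          (s₄.var 8 = 0 ∧ PriceInv E N (P i) (s₄.arr 7) (s₄.arr 8) (s₄.var 9)) ∨
          (s₄.var 9 = 0 ∧ ∃ r, s₄.var 8 = r + 1 ∧ Violates (P i) E r))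
        (μ := fun s₄ => N * N - ∑ c ∈ Finset.range N, s₄.arr 8 c) ?_ (.inl ⟨y8, hI₃⟩)).mono ?_ ?_
      · intro s₄ hF₄ hI₄ h9
        obtain ⟨z8, hI₄⟩ := hI₄.resolve_right fun h => h9 h.1
        obtain ⟨r, hr⟩ := Nat.exists_eq_succ_of_ne_zero h9
        have zarr : ∀ r < 7, s₄.arr r = s.arr r := fun r hr => by
          rw [hF₄.arr r (by simp [priceStep, scanEntry]; omega), yarr, xarr r hr]
        refine (haltsWithin_priceStep (m := m) (N := N)
          ((hF₄.var 1 (by simp [priceStep, scanEntry])).trans y1)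
          ((hF₄.var 5 (by simp [priceStep, scanEntry])).trans y5)
          ((hF₄.var 6 (by simp [priceStep, scanEntry])).trans y6) z8
          ((zarr 6 (by omega)).trans hok) ((zarr R hR7).trans hR) ((zarr C hC7).trans hC)
          hN hE hr hI₄).mono le_rfl ?_
        rintro s₅ (⟨h, h', hsum⟩ | h)
        · refine ⟨.inl ⟨h, h'⟩, .inr ?_⟩
          have := h'.sum_le
          omega
        · exact ⟨.inr h, .inl h.1⟩
      · have : N * N - ∑ c ∈ Finset.range N, s₃.arr 8 c ≤ N * N := Nat.sub_le _ _
        rw [← hK]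
        exact Nat.add_le_add_right
          (Nat.mul_le_mul_right (m * 22 + 21) (Nat.add_le_add_right this 1)) 1
      · rintro s₄ ⟨h | h, h9⟩
        · exact .inl ⟨h.1, h9 ▸ h.2⟩
        · exact .inr h.2
  · refine .inl ⟨w8, ?_⟩
    have : P (s₁.var cnt) = ∅ := by
      rw [wcnt]
      exact Set.eq_empty_of_forall_notMem fun r hr => absurd hr.1 (by have := hr.2.1; omega)
    rw [this]
    exact .init hfree
  · rintro s₂ (⟨h8, h⟩ | h)
    · exact .inl ⟨h8, h.saturable⟩
    · exact .inr h

end PopularMatching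

/-! ### The program for the demand -/

namespace PopularMatching

open RandomAccess RandomAccess.Program

/-- Compares the entry `u` in the variable `8`, whose group and discount are in the variables `13`
and `12`, to the entry `v` in the variable `9`, and sets the variable `14` to zero if `v` shows that
`u` is not in demand. -/
def checkPair : Program :=
  block [.load 15 1 9, .sub 16 15 13, .sub 17 13 15, .add 16 16 17,
    .cond 16 .skip (block [.load 15 3 9, .load 15 5 15, .sub 16 8 9,
      .cond 16 (block [.sub 17 12 15, .cond 17 .skip (.const 14 0)])
        (block [.sub 16 9 8, .cond 16
          (block [.sub 17 15 12, .sub 17 17 1, .cond 17 (.const 14 0) .skip]) .skip])])]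

/-- Compares the entry `u` in the variable `8` to all other entries of its group, provided that its
agent and job are those in the variables `10` and `11`. -/
def checkEntry : Program :=
  block [.load 15 2 8, .sub 16 15 10, .sub 17 10 15, .add 18 16 17,
    .load 15 3 8, .sub 16 15 11, .sub 17 11 15, .add 16 16 17, .add 18 18 16,
    .cond 18 .skip (block [.load 13 1 8, countdown 9 5 checkPair])]

/-- Marks in the array `6` the entries whose job is demanded by their agent at the discounts in the
array `5`.  The arrays `1`, `2` and `3` hold the groups, agents and jobs of the entries. -/
def markDemand : Program :=
  countdown 7 5 (block [.load 10 2 7, .load 11 3 7, .load 12 5 11, .const 14 1,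
    countdown 8 5 checkEntry, .store 6 7 14])

/-- The entry `v` does not show that a job of discount `x` at the entry `u` is not in demand.  Here
`γ` and `β` are the groups and the jobs of the entries; a group lists its jobs from the best to the
worst. -/
def FitsPair (γ β d : ℕ → ℕ) (u x v : ℕ) : Prop :=
  γ v = γ u → (v < u → d (β v) < x) ∧ (u < v → d (β v) ≤ x + 1)

/-- No entry shows that the job of the entry `t` is not demanded by the agent of `t`. -/
def FitsEntry (m : ℕ) (γ κ β d : ℕ → ℕ) (t : ℕ) : Prop :=
  ∀ u < m, κ u = κ t → β u = β t → ∀ v < m, FitsPair γ β d u (d (β t)) v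

theorem eval_checkPair {s : State} (h1 : s.var 1 = 1)
    (hg : s.var 13 = s.arr 1 (s.var 8)) :
    (checkPair.eval s).var 14 ≠ 0 ↔
      s.var 14 ≠ 0 ∧ FitsPair (s.arr 1) (s.arr 3) (s.arr 5) (s.var 8) (s.var 12) (s.var 9) := by
  unfold FitsPair
  rw [← hg]
  by_cases hgr : s.arr 1 (s.var 9) = s.var 13
  · rcases lt_trichotomy (s.var 9) (s.var 8) with hlt | heq | hlt
    · by_cases hd : s.arr 5 (s.arr 3 (s.var 9)) < s.var 12
      · simp [checkPair, hgr, Nat.sub_eq_zero_iff_le, not_le.2 hlt, hlt, hd, not_le.2 hd,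
          hlt.le]
      · simp [checkPair, hgr, Nat.sub_eq_zero_iff_le, not_le.2 hlt, hlt, hd, not_lt.1 hd]
    · rw [heq] at hgr
      simp [checkPair, hgr, heq]
    · by_cases hd : s.arr 5 (s.arr 3 (s.var 9)) ≤ s.var 12 + 1
      · have hd' : s.arr 5 (s.arr 3 (s.var 9)) - s.var 12 ≤ 1 := by omega
        simp [checkPair, hgr, Nat.sub_eq_zero_iff_le, not_le.2 hlt, hlt, hd, hd', h1,
          hlt.le]
      · have hd' : ¬ s.arr 5 (s.arr 3 (s.var 9)) - s.var 12 ≤ 1 := by omega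
        simp [checkPair, hgr, Nat.sub_eq_zero_iff_le, not_le.2 hlt, hlt, hd, hd', h1,
          hlt.le]
  · have hgr' : ¬ (s.arr 1 (s.var 9) ≤ s.var 13 ∧ s.var 13 ≤ s.arr 1 (s.var 9)) :=
      fun h => hgr (le_antisymm h.1 h.2)
    simp [checkPair, hgr, hgr', Nat.sub_eq_zero_iff_le]

theorem haltsWithin_checkEntry {s : State} (h1 : s.var 1 = 1) :
    HaltsWithin checkEntry (s.var 5 * 29 + 20) s fun s' =>
      (s'.var 14 ≠ 0 ↔ s.var 14 ≠ 0 ∧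
        (s.arr 2 (s.var 8) = s.var 10 → s.arr 3 (s.var 8) = s.var 11 →
          ∀ v < s.var 5, FitsPair (s.arr 1) (s.arr 3) (s.arr 5) (s.var 8) (s.var 12) v)) := by
  refine HaltsWithin.mono (T₁ := (s.var 5 * 29 + 2 + 2 + 1 + (0 + 1)) + 1 + 1 + 1 + 1 + 1 + 1 +
    1 + 1 + 1) ?_ (by omega) fun _ h => h
  iterate 9 refine .cons_step (by simp) (by simp) ?_
  refine .cons (T₁ := s.var 5 * 29 + 2 + 2 + 1) (T₂ := 0 + 1) (.cond (fun h => ?_) (fun h => ?_))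
    fun s₁ _ h => .nil h
  · refine .of_loopFree (by simp) (by simp) ?_
    simp only [eval, State.setVar, Function.update_apply] at h ⊢
    simp only [Nat.reduceEqDiff, if_false, if_true] at h ⊢
    have : ¬ (s.arr 2 (s.var 8) = s.var 10 ∧ s.arr 3 (s.var 8) = s.var 11) := by
      rintro ⟨h2, h3⟩
      rw [h2, h3] at h
      omega
    tauto
  · have h23 : s.arr 2 (s.var 8) = s.var 10 ∧ s.arr 3 (s.var 8) = s.var 11 := by
      simp only [eval, State.setVar, Function.update_apply] at h
      simp only [Nat.reduceEqDiff, if_false, if_true] at h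
      omega
    refine .cons_step (T := s.var 5 * 29 + 2 + 1) (by simp) (by simp) ?_
    refine .cons (T₁ := s.var 5 * 29 + 2) (T₂ := 0 + 1) ?_ fun s₁ _ h => .nil h
    generalize hs₀ : eval _ _ = s₀
    have w : ∀ x ≤ 12, s₀.var x = s.var x := by
      intro x hx
      have h13 : x ≠ 13 := by omega
      have h15 : x ≠ 15 := by omega
      have h16 : x ≠ 16 := by omega
      have h17 : x ≠ 17 := by omega
      have h18 : x ≠ 18 := by omega
      simp [← hs₀, h13, h15, h16, h17, h18]
    have w13 : s₀.var 13 = s.arr 1 (s.var 8) := by simp [← hs₀]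
    have w14 : s₀.var 14 = s.var 14 := by simp [← hs₀]
    have warr : s₀.arr = s.arr := by simp [← hs₀]
    have h5 := w 5 (by omega)
    let Inv : ℕ → State → Prop := fun i s₁ => s₁.var 14 ≠ 0 ↔ s.var 14 ≠ 0 ∧
      ∀ v, i ≤ v → v < s.var 5 →
        FitsPair (s.arr 1) (s.arr 3) (s.arr 5) (s.var 8) (s.var 12) v
    rw [← h5]
    refine (HaltsWithin.countdown Inv (T := 27) (by simp [checkPair]) (by simp)
      (by simp [checkPair]) (by rw [w 1 (by omega), h1]) ?_ ?_ ?_).mono le_rfl ?_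
    · intro i s₁ v h
      simpa [Inv] using h
    · intro i hi s₁ hF hx hI
      refine .of_loopFree (by simp [checkPair]) (by simp [checkPair]) ?_
      have a8 : s₁.var 8 = s.var 8 := (hF.var 8 (by simp [checkPair])).trans (w 8 (by omega))
      have a12 : s₁.var 12 = s.var 12 := (hF.var 12 (by simp [checkPair])).trans (w 12 (by omega))
      have a13 : s₁.var 13 = s.arr 1 (s.var 8) := (hF.var 13 (by simp [checkPair])).trans w13
      have a1 : s₁.var 1 = 1 :=
        (hF.var 1 (by simp [checkPair])).trans ((w 1 (by omega)).trans h1)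
      have aarr : s₁.arr = s.arr := funext fun r => by
        rw [hF.arr r (by simp [checkPair]), warr]
      simp only [Inv] at hI ⊢
      rw [eval_checkPair a1 (by rw [a13, a8, aarr]), hI, a8, a12, aarr, hx, and_assoc,
        and_congr_right_iff]
      intro _
      constructor
      · rintro ⟨h1, h2⟩ v hv hv'
        rcases hv.eq_or_lt with rfl | hv
        · exact h2
        · exact h1 v hv hv'
      · exact fun h => ⟨fun v hv => h v (by omega), h i le_rfl (by omega)⟩
    · simp only [Inv, w14, h5]
      exact (and_iff_left fun v h h' => absurd h (by omega)).symm
    · intro s₁ h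
      simp only [Inv] at h
      rw [h]
      simp [h23, h5]

theorem haltsWithin_markDemand {s : State} (h1 : s.var 1 = 1) :
    HaltsWithin markDemand (s.var 5 * (s.var 5 * (s.var 5 * 29 + 22) + 12) + 2) s fun s' =>
      ∀ t < s.var 5, (s'.arr 6 t ≠ 0 ↔
        FitsEntry (s.var 5) (s.arr 1) (s.arr 2) (s.arr 3) (s.arr 5) t) := by
  obtain ⟨K, hK⟩ : ∃ K, s.var 5 * (s.var 5 * 29 + 22) = K := ⟨_, rfl⟩
  rw [hK]
  let Inv : ℕ → State → Prop := fun i s₁ => ∀ t, i ≤ t → t < s.var 5 → (s₁.arr 6 t ≠ 0 ↔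
    FitsEntry (s.var 5) (s.arr 1) (s.arr 2) (s.arr 3) (s.arr 5) t)
  refine (HaltsWithin.countdown Inv (T := K + 10) (by simp [checkEntry, checkPair]) (by simp)
    (by simp [checkEntry, checkPair]) h1 ?_ ?_ ?_).mono le_rfl ?_
  · intro i s₁ v h
    simpa [Inv] using h
  · intro t ht s₁ hF hx hI
    have a1 : s₁.var 1 = 1 := (hF.var 1 (by simp [checkEntry, checkPair])).trans h1
    have a5 : s₁.var 5 = s.var 5 := hF.var 5 (by simp [checkEntry, checkPair])
    have aarr : ∀ r < 6, s₁.arr r = s.arr r := fun r hr =>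
      hF.arr r (by simp [checkEntry, checkPair]; omega)
    refine HaltsWithin.mono (T₁ := (K + 2 + (0 + 1 + 1)) + 1 + 1 + 1 + 1) ?_ (by omega)
      fun _ h => h
    iterate 4 refine .cons_step (by simp) (by simp) ?_
    generalize hs₀ : eval _ _ = s₀
    have w1 : s₀.var 1 = 1 := by simp [← hs₀, a1]
    have w5 : s₀.var 5 = s.var 5 := by simp [← hs₀, a5]
    have w7 : s₀.var 7 = t := by simp [← hs₀, hx]
    have w10 : s₀.var 10 = s.arr 2 t := by simp [← hs₀, hx, aarr]
    have w11 : s₀.var 11 = s.arr 3 t := by simp [← hs₀, hx, aarr]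
    have w12 : s₀.var 12 = s.arr 5 (s.arr 3 t) := by simp [← hs₀, hx, aarr]
    have w14 : s₀.var 14 = 1 := by simp [← hs₀]
    have warr : s₀.arr = s₁.arr := by simp [← hs₀]
    let Inv₂ : ℕ → State → Prop := fun i s₂ => s₂.var 14 ≠ 0 ↔
      ∀ u, i ≤ u → u < s.var 5 → s.arr 2 u = s.arr 2 t → s.arr 3 u = s.arr 3 t →
        ∀ v < s.var 5, FitsPair (s.arr 1) (s.arr 3) (s.arr 5) u (s.arr 5 (s.arr 3 t)) v
    refine .cons (T₁ := K + 2) (T₂ := 0 + 1 + 1) (R := fun s₂ =>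
      (s₂.var 14 ≠ 0 ↔ FitsEntry (s.var 5) (s.arr 1) (s.arr 2) (s.arr 3) (s.arr 5) t)) ?_ ?_
    · rw [← hK, ← w5]
      refine (HaltsWithin.countdown Inv₂ (T := s₀.var 5 * 29 + 20)
        (by simp [checkEntry, checkPair]) (by simp) (by simp [checkEntry, checkPair]) w1
        ?_ ?_ ?_).mono le_rfl ?_
      · intro i s₂ v h
        simpa [Inv₂] using h
      · intro u hu s₂ hF₂ hx₂ hI₂
        have b : ∀ x < 13, x ≠ 8 → x ≠ 9 → s₂.var x = s₀.var x := fun x hx h8 h9 =>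
          hF₂.var x (by simp [checkEntry, checkPair]; omega)
        have barr : ∀ r < 6, s₂.arr r = s.arr r := fun r hr => by
          rw [hF₂.arr r (by simp [checkEntry, checkPair]), warr, aarr r hr]
        have b5 := b 5 (by omega) (by omega) (by omega)
        refine (haltsWithin_checkEntry
          ((b 1 (by omega) (by omega) (by omega)).trans w1)).mono (by rw [b5]) ?_
        intro s₃ h₃
        rw [barr 1 (by omega), barr 2 (by omega), barr 3 (by omega), barr 5 (by omega), b5,
          b 10 (by omega) (by omega) (by omega), b 11 (by omega) (by omega) (by omega),
          b 12 (by omega) (by omega) (by omega), hx₂, w5, w10, w11, w12] at h₃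
        simp only [Inv₂] at hI₂ ⊢
        rw [h₃, hI₂]
        constructor
        · rintro ⟨h1, h2⟩ u' hu' hu''
          rcases hu'.eq_or_lt with rfl | hu'
          · exact h2
          · exact h1 u' hu' hu''
        · exact fun h => ⟨fun u' hu' => h u' (by omega), h u le_rfl (by omega)⟩
      · simp only [Inv₂, w14, w5]
        exact iff_of_true one_ne_zero fun u h h' => absurd h (by omega)
      · intro s₂ h
        simp only [Inv₂] at h
        rw [h, FitsEntry, w5]
        simp
    · intro s₂ hF₂ h
      refine .cons_step (by simp) (by simp) (.nil ?_)
      have b7 : s₂.var 7 = t := (hF₂.var 7 (by simp [checkEntry, checkPair])).trans w7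
      have b6 : s₂.arr 6 = s₁.arr 6 := by
        rw [hF₂.arr 6 (by simp [checkEntry, checkPair]), warr]
      intro t' ht' ht''
      rcases ht'.eq_or_lt with rfl | ht'
      · simpa [b7] using h
      · have := hI t' ht' ht''
        simpa [b7, b6, Function.update_apply, ht'.ne'] using this
  · exact fun t h h' => absurd h (by omega)
  · exact fun s₁ h t ht => h t (Nat.zero_le _) ht

end PopularMatching

/-! ### The program for the auction -/

namespace PopularMatching

open RandomAccess RandomAccess.Program

/-- One round of the auction: if the jobs of discount at most `1` cannot all be matched, the
discount of an uncovered job is raised. -/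
def auctionRound : Program :=
  block [markDemand, matchRows 3 2 5 3,
    .cond 8 (block [.sub 9 8 1, .load 10 5 9, .add 10 10 1, .store 5 9 10]) .skip]

/-- The auction, followed by the search for a matching of all agents.  The array `4` is zero, so
that all agents are searched for. -/
def auction : Program :=
  block [.const 8 1, .loop 8 auctionRound, matchRows 2 3 4 2, .sub 0 1 8]

/-- A bound for the number of steps of `markDemand`. -/
def markTime (m : ℕ) : ℕ := m * (m * (m * 29 + 22) + 12) + 2

/-- A bound for the number of steps of `matchRows`. -/
def matchTime (m N c : ℕ) : ℕ := N * 5 + 2 + (c * ((N * N + 1) * (m * 22 + 21) + 12) + 6)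

/-- The first `m` entries of the groups `γ`, the agents `κ` and the jobs `β` represent the
preference lists `ℓ`. -/
def Represents (m : ℕ) (γ κ β : ℕ → ℕ) (ℓ : List (ℕ × List ℕ)) : Prop :=
  ∀ d a b, (∃ t < m, FitsEntry m γ κ β d t ∧ κ t = a ∧ β t = b) ↔ Demands ℓ d a b

section

variable {ℓ : List (ℕ × List ℕ)} {m nA nB : ℕ} {γ κ β d : ℕ → ℕ}

theorem Represents.entryGraph (h : Represents m γ κ β ℓ) {ok : ℕ → ℕ}
    (hok : ∀ t < m, (ok t ≠ 0 ↔ FitsEntry m γ κ β d t)) :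
    EntryGraph m ok κ β = Demands ℓ d := by
  funext a b
  rw [← h d a b]
  exact propext (exists_congr fun t => and_congr_right fun ht => and_congr_left fun _ => hok t ht)

theorem Represents.entryGraph_swap (h : Represents m γ κ β ℓ) {ok : ℕ → ℕ}
    (hok : ∀ t < m, (ok t ≠ 0 ↔ FitsEntry m γ κ β d t)) :
    EntryGraph m ok β κ = fun b a => Demands ℓ d a b := by
  funext b a
  rw [← h.entryGraph hok]
  exact propext (exists_congr fun t => by rw [and_comm (a := β t = b)])

theorem haltsWithin_auctionRound {s : State} (h1 : s.var 1 = 1) (h3 : s.var 3 = nB)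
    (h5 : s.var 5 = m) (h6 : s.var 6 = nA + nB + 2) (hγ : s.arr 1 = γ) (hκ : s.arr 2 = κ)
    (hβ : s.arr 3 = β) (hrep : Represents m γ κ β ℓ)
    (hℓ : ∀ a L, (a, L) ∈ ℓ → a < nA ∧ ∀ b ∈ L, b < nB ∨ b = nB + a)
    (hd : IsLowerBound ℓ nA nB (s.arr 5)) :
    HaltsWithin auctionRound (markTime m + (matchTime m (nA + nB + 2) nB + 8)) s fun s' =>
      IsLowerBound ℓ nA nB (s'.arr 5) ∧
      ((s'.var 8 = 0 ∧ (∀ t < m, (s'.arr 6 t ≠ 0 ↔ FitsEntry m γ κ β (s'.arr 5) t)) ∧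
        Saturable (Tight nB (s'.arr 5)) fun b a => Demands ℓ (s'.arr 5) a b) ∨
      (s'.var 8 ≠ 0 ∧
        ∑ b ∈ Finset.range nB, (2 - s'.arr 5 b) < ∑ b ∈ Finset.range nB, (2 - s.arr 5 b))) := by
  subst hγ hκ hβ h5
  refine .cons (haltsWithin_markDemand h1) fun s₁ hF hok => ?_
  have a5 : s₁.var 5 = s.var 5 := hF.var 5 (by simp [markDemand, checkEntry, checkPair])
  have a1 : s₁.var 1 = 1 := (hF.var 1 (by simp [markDemand, checkEntry, checkPair])).trans h1
  have a3 : s₁.var 3 = nB := (hF.var 3 (by simp [markDemand, checkEntry, checkPair])).trans h3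
  have a6 : s₁.var 6 = nA + nB + 2 :=
    (hF.var 6 (by simp [markDemand, checkEntry, checkPair])).trans h6
  have aarr : ∀ r < 6, s₁.arr r = s.arr r := fun r hr =>
    hF.arr r (by simp [markDemand, checkEntry, checkPair]; omega)
  have hgraph := hrep.entryGraph_swap hok
  have hE : ∀ b a, EntryGraph (s.var 5) (s₁.arr 6) (s.arr 3) (s.arr 2) b a →
      a + 2 < nA + nB + 2 := by
    intro b a hba
    rw [hgraph] at hba
    obtain ⟨L, hL⟩ := hba.1
    have h1 := (hℓ a L hL).1
    omega
  refine .cons (T₂ := 8) (T₁ := matchTime (s.var 5) (nA + nB + 2) nB)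
    ((haltsWithin_matchRows (C := 2) (D := 5) (m := s.var 5) (N := nA + nB + 2)
      (ok := s₁.arr 6) (ρ := s.arr 3) (γ := s.arr 2)
      a1 a5 a6 rfl (aarr 3 (by omega))
      (aarr 2 (by omega)) (aarr 5 (by omega)) (by omega) (by omega) (by omega) (by omega)
      (by omega) hE).mono (by rw [a3, matchTime]) fun _ h => h) fun s₂ hF₂ h₂ => ?_
  rw [hgraph, a3] at h₂
  have b1 : s₂.var 1 = 1 := (hF₂.var 1 (by simp [matchRows, priceStep, scanEntry])).trans a1
  have barr : ∀ r < 7, s₂.arr r = s₁.arr r := fun r hr =>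
    hF₂.arr r (by simp [matchRows, priceStep, scanEntry]; omega)
  have b5 : s₂.arr 5 = s.arr 5 := (barr 5 (by omega)).trans (aarr 5 (by omega))
  refine .of_loopFree (by simp) (by simp) ?_
  rcases h₂ with ⟨h8, hsat⟩ | ⟨b, h8, hv⟩
  · have : (block [.cond 8 (block [.sub 9 8 1, .load 10 5 9, .add 10 10 1, .store 5 9 10])
        .skip]).eval s₂ = s₂ := by simp [h8]
    rw [this, b5]
    refine ⟨hd, .inl ⟨h8, fun t ht => ?_, hsat⟩⟩
    rw [barr 6 (by omega)]
    exact hok t ht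
  · generalize hs₃ : eval _ _ = s₃
    have c5 : s₃.arr 5 = Function.update (s.arr 5) b (s.arr 5 b + 1) := by
      rw [← hs₃]
      simp [h8, b1, b5]
    have c8 : s₃.var 8 ≠ 0 := by simp [← hs₃, h8]
    rw [c5]
    refine ⟨hd.update hv, .inr ⟨c8, Finset.sum_lt_sum (fun x _ => ?_)
      ⟨b, Finset.mem_range.2 hv.1.1, ?_⟩⟩⟩
    · by_cases hx : x = b
      · subst hx; simp only [Function.update_self]; omega
      · rw [Function.update_of_ne hx]
    · have := hv.1.2
      simp only [Function.update_self]; omega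

theorem haltsWithin_auction {s : State} (h1 : s.var 1 = 1) (h2 : s.var 2 = nA)
    (h3 : s.var 3 = nB) (h5 : s.var 5 = m) (h6 : s.var 6 = nA + nB + 2)
    (hrep : Represents m (s.arr 1) (s.arr 2) (s.arr 3) ℓ)
    (h4 : ∀ a, s.arr 4 a = 0)
    (hℓ : ∀ a L, (a, L) ∈ ℓ → a < nA ∧ ∀ b ∈ L, b < nB ∨ b = nB + a)
    (hd : IsLowerBound ℓ nA nB (s.arr 5)) :
    HaltsWithin auction ((2 * nB + 1) * (markTime m + (matchTime m (nA + nB + 2) nB + 9)) +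
      matchTime m (nA + nB + 2) nA + 10) s fun s' =>
      (s'.var 0 ≠ 0 ↔ ∃ α f, IsEquilibrium ℓ nA nB α f) := by
  obtain ⟨K, hK⟩ : ∃ K, markTime m + (matchTime m (nA + nB + 2) nB + 8) = K := ⟨_, rfl⟩
  refine HaltsWithin.mono (T₁ := ((2 * nB + 1) * (K + 1) + 1) +
    (matchTime m (nA + nB + 2) nA + (0 + 1 + 1)) + 1) ?_ (by rw [← hK]; ring_nf; omega)
    fun _ h => h
  refine .cons_step (by simp) (by simp) ?_
  generalize hs₀ : eval _ _ = s₀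
  have w : ∀ x < 8, s₀.var x = s.var x := fun x hx => by
    have : x ≠ 8 := by omega
    simp [← hs₀, this]
  have warr : s₀.arr = s.arr := by simp [← hs₀]
  have w8 : s₀.var 8 ≠ 0 := by simp [← hs₀]
  refine .cons (T₁ := (2 * nB + 1) * (K + 1) + 1) (T₂ := matchTime m (nA + nB + 2) nA + (0 + 1 + 1))
    (R := fun s₁ => IsLowerBound ℓ nA nB (s₁.arr 5) ∧
      (∀ t < m, (s₁.arr 6 t ≠ 0 ↔ FitsEntry m (s.arr 1) (s.arr 2) (s.arr 3) (s₁.arr 5) t)) ∧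
        Saturable (Tight nB (s₁.arr 5)) fun b a => Demands ℓ (s₁.arr 5) a b) ?_ ?_
  · refine (HaltsWithin.loop (T := K)
      (Inv := fun s₁ => IsLowerBound ℓ nA nB (s₁.arr 5) ∧ (s₁.var 8 = 0 →
        (∀ t < m, (s₁.arr 6 t ≠ 0 ↔ FitsEntry m (s.arr 1) (s.arr 2) (s.arr 3) (s₁.arr 5) t)) ∧
          Saturable (Tight nB (s₁.arr 5)) fun b a => Demands ℓ (s₁.arr 5) a b))
      (μ := fun s₁ => ∑ b ∈ Finset.range nB, (2 - s₁.arr 5 b)) ?_ ?_).mono ?_ ?_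
    · rintro s₁ hF ⟨hI, -⟩ h8
      have b : ∀ x < 7, s₁.var x = s.var x := fun x hx => by
        rw [hF.var x (by simp [auctionRound, markDemand, checkEntry, checkPair, matchRows,
          priceStep, scanEntry]; omega), w x (by omega)]
      have barr : ∀ r < 5, s₁.arr r = s.arr r := fun r hr => by
        rw [hF.arr r (by simp [auctionRound, markDemand, checkEntry, checkPair, matchRows,
          priceStep, scanEntry]; omega), warr]
      refine (haltsWithin_auctionRound (m := m) ((b 1 (by omega)).trans h1)
        ((b 3 (by omega)).trans h3)
        ((b 5 (by omega)).trans h5) ((b 6 (by omega)).trans h6) (barr 1 (by omega))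
        (barr 2 (by omega)) (barr 3 (by omega)) hrep hℓ hI).mono hK.le ?_
      rintro s₂ ⟨hd₂, h | h⟩
      · exact ⟨⟨hd₂, fun _ => h.2⟩, .inl h.1⟩
      · exact ⟨⟨hd₂, fun h8 => absurd h8 h.1⟩, .inr h.2⟩
    · exact ⟨warr ▸ hd, fun h => absurd h w8⟩
    · have : ∑ b ∈ Finset.range nB, (2 - s₀.arr 5 b) ≤ 2 * nB := by
        refine (Finset.sum_le_card_nsmul _ _ 2 fun _ _ => Nat.sub_le _ _).trans ?_
        simp [mul_comm]
      exact Nat.add_le_add_right (Nat.mul_le_mul_right _ (Nat.add_le_add_right this 1)) 1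
    · rintro s₁ ⟨⟨h, h'⟩, h8⟩
      exact ⟨h, h' h8⟩
  · rintro s₁ hF ⟨hd₁, hok, hsat⟩
    have b : ∀ x < 7, s₁.var x = s.var x := fun x hx => by
      rw [hF.var x (by simp [auctionRound, markDemand, checkEntry, checkPair, matchRows,
        priceStep, scanEntry]; omega), w x (by omega)]
    have barr : ∀ r < 5, s₁.arr r = s.arr r := fun r hr => by
      rw [hF.arr r (by simp [auctionRound, markDemand, checkEntry, checkPair, matchRows,
        priceStep, scanEntry]; omega), warr]
    have hgraph := hrep.entryGraph hok
    have hE : ∀ a b, EntryGraph m (s₁.arr 6) (s.arr 2) (s.arr 3) a b →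
        b + 2 < nA + nB + 2 := by
      intro a b hab
      rw [hgraph] at hab
      obtain ⟨L, hL⟩ := hab.1
      have h1 := hℓ a L hL
      have h2 := h1.2 b (hab.2 L hL).1
      omega
    refine .cons (T₂ := 0 + 1 + 1) (T₁ := matchTime m (nA + nB + 2) nA)
      ((haltsWithin_matchRows (C := 3) (D := 4) (m := m) (N := nA + nB + 2) (δ := s.arr 4)
        (ok := s₁.arr 6) (ρ := s.arr 2) (γ := s.arr 3) ((b 1 (by omega)).trans h1)
        ((b 5 (by omega)).trans h5) ((b 6 (by omega)).trans h6) rfl (barr 2 (by omega))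
        (barr 3 (by omega)) (barr 4 (by omega)) (by omega) (by omega) (by omega) (by omega)
        (by omega) hE).mono (by rw [b 2 (by omega), h2, matchTime]) fun _ h => h)
      fun s₂ hF₂ h₂ => ?_
    refine .cons_step (by simp) (by simp) (.nil ?_)
    have c1 : s₂.var 1 = 1 :=
      (hF₂.var 1 (by simp [matchRows, priceStep, scanEntry])).trans ((b 1 (by omega)).trans h1)
    have hrows : {r | r < s₁.var 2 ∧ s.arr 4 r ≤ 1} = Set.Iio nA := by
      ext a
      simp [b 2 (by omega), h2, h4]
    rw [hgraph, hrows] at h₂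
    rw [← hd₁.saturable_agents_iff hℓ hsat]
    rcases h₂ with ⟨h8, h⟩ | ⟨r, h8, h⟩
    · simp [h8, c1, h]
    · simp [h8, c1, h.not_saturable]

end

end PopularMatching

/-! ### Reading the input -/

namespace RandomAccess

/-- Counting loops which work through a list. -/
theorem HaltsWithin.countdown_list {α : Type*} {p : Program} {T : ℕ} {s : State} {x n : ℕ}
    (xs : List α) (hn : s.var n = xs.length)
    (Inv : List α → State → Prop) (hx : x ∉ p.writtenVars)
    (h1x : 1 ≠ x) (h1 : 1 ∉ p.writtenVars) (hs : s.var 1 = 1)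
    (hInv : ∀ l s₁ v, Inv l s₁ → Inv l (s₁.setVar x v))
    (step : ∀ l y r, xs = l ++ y :: r → ∀ s₁, Frame (.countdown x n p) s s₁ → Inv l s₁ →
      HaltsWithin p T s₁ (Inv (l ++ [y])))
    (h₀ : Inv [] s) :
    HaltsWithin (.countdown x n p) (xs.length * (T + 2) + 2) s (Inv xs) := by
  have := HaltsWithin.countdown (n := n) (s := s) (T := T)
    (fun i s₁ => Inv (xs.take (xs.length - i)) s₁) hx h1x h1 hs
    (fun i s₁ v h => hInv _ s₁ v h) ?_ ?_
  · rw [hn] at this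
    exact this.mono le_rfl fun s' h => by simpa using h
  · intro i hi s₁ hF _ hI
    rw [hn] at hi
    have hlt : xs.length - (i + 1) < xs.length := by omega
    have e1 : xs.length - i = xs.length - (i + 1) + 1 := by omega
    have := step (xs.take (xs.length - (i + 1))) xs[xs.length - (i + 1)]
      (xs.drop (xs.length - i)) (by rw [e1, List.getElem_cons_drop, List.take_append_drop]) s₁ hF hI
    rw [List.take_append_getElem, ← e1] at this
    exact this
  · simpa [hn] using h₀

end RandomAccess

namespace PopularMatching

open RandomAccess RandomAccess.Program

/-- The entries of the preference lists `ℓ`: triples of a group, which is the number of the list, an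
agent and a job. -/
def entries (ℓ : List (ℕ × List ℕ)) : List (ℕ × ℕ × ℕ) :=
  ℓ.zipIdx.flatMap fun p => p.1.2.map fun b => (p.2, p.1.1, b)

theorem entries_append (ℓ : List (ℕ × List ℕ)) (a : ℕ) (L : List ℕ) :
    entries (ℓ ++ [(a, L)]) = entries ℓ ++ L.map fun b => (ℓ.length, a, b) := by
  simp [entries, List.zipIdx_append]

/-- The entries of every list are contiguous. -/
theorem exists_offset (ℓ : List (ℕ × List ℕ)) : ∃ off : ℕ → ℕ,
    (∀ g a L, ℓ[g]? = some (a, L) → ∀ j b, L[j]? = some b →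
      (entries ℓ)[off g + j]? = some (g, a, b)) ∧
    ∀ t g a b, (entries ℓ)[t]? = some (g, a, b) →
      ∃ L j, ℓ[g]? = some (a, L) ∧ L[j]? = some b ∧ t = off g + j := by
  induction ℓ using List.reverseRecOn with
  | nil => exact ⟨id, by simp, by simp [entries]⟩
  | append_singleton ℓ p ih =>
    obtain ⟨a₀, L₀⟩ := p
    obtain ⟨off, h1, h2⟩ := ih
    refine ⟨Function.update off ℓ.length (entries ℓ).length, ?_, ?_⟩
    · intro g a L hg j b hj
      rw [entries_append]
      rw [List.getElem?_append] at hg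
      split_ifs at hg with hlt
      · rw [Function.update_of_ne hlt.ne]
        have := h1 g a L hg j b hj
        rw [List.getElem?_append_left (List.getElem?_eq_some_iff.1 this).1, this]
      · have hg0 : g - ℓ.length = 0 := by
          have := (List.getElem?_eq_some_iff.1 hg).1
          simp at this; omega
        have hg' : g = ℓ.length := by omega
        rw [hg0] at hg
        simp only [List.getElem?_cons_zero, Option.some.injEq, Prod.mk.injEq] at hg
        obtain ⟨rfl, rfl⟩ := hg
        subst hg'
        rw [Function.update_self, List.getElem?_append_right (Nat.le_add_right _ _),
          Nat.add_sub_cancel_left, List.getElem?_map, hj]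
        rfl
    · intro t g a b ht
      rw [entries_append, List.getElem?_append] at ht
      split_ifs at ht with hlt
      · obtain ⟨L, j, hg, hj, rfl⟩ := h2 t g a b ht
        have hgl := (List.getElem?_eq_some_iff.1 hg).1
        exact ⟨L, j, by rw [List.getElem?_append_left hgl, hg], hj,
          by rw [Function.update_of_ne hgl.ne]⟩
      · rw [List.getElem?_map, Option.map_eq_some_iff] at ht
        obtain ⟨b', hb', he⟩ := ht
        simp only [Prod.mk.injEq] at he
        obtain ⟨rfl, rfl, rfl⟩ := he
        exact ⟨L₀, _, by simp, hb', by rw [Function.update_self]; omega⟩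

/-- The first `m` entries of the arrays are the triples in the list `E`. -/
def Holds (m : ℕ) (γ κ β : ℕ → ℕ) (E : List (ℕ × ℕ × ℕ)) : Prop :=
  m = E.length ∧ ∀ t < m, E[t]? = some (γ t, κ t, β t)

theorem Holds.append {m : ℕ} {γ κ β : ℕ → ℕ} {E : List (ℕ × ℕ × ℕ)} (h : Holds m γ κ β E)
    (g a b : ℕ) : Holds (m + 1) (Function.update γ m g) (Function.update κ m a)
      (Function.update β m b) (E ++ [(g, a, b)]) := by
  refine ⟨by simp [h.1], fun t ht => ?_⟩
  by_cases htm : t = m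
  · subst htm
    simp [h.1]
  · have hlt : t < m := by omega
    rw [List.getElem?_append_left (h.1 ▸ hlt), h.2 t hlt]
    simp [Function.update_of_ne htm]

theorem Holds.represents {m : ℕ} {γ κ β : ℕ → ℕ} {ℓ : List (ℕ × List ℕ)}
    (h : Holds m γ κ β (entries ℓ)) (hnd : ∀ a L, (a, L) ∈ ℓ → L.Nodup)
    (hsame : ∀ a L L', (a, L) ∈ ℓ → (a, L') ∈ ℓ → L ⊆ L') : Represents m γ κ β ℓ := by
  obtain ⟨off, h1, h2⟩ := exists_offset ℓ
  have hpos : ∀ g a L, ℓ[g]? = some (a, L) → ∀ j b, L[j]? = some b →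
      off g + j < m ∧ γ (off g + j) = g ∧ κ (off g + j) = a ∧ β (off g + j) = b := by
    intro g a L hg j b hj
    have he := h1 g a L hg j b hj
    have hlt : off g + j < m := h.1 ▸ (List.getElem?_eq_some_iff.1 he).1
    rw [h.2 _ hlt] at he
    simp only [Option.some.injEq, Prod.mk.injEq] at he
    exact ⟨hlt, he⟩
  have hidx : ∀ a L, (a, L) ∈ ℓ → ∀ j b, L[j]? = some b → L.idxOf b = j := by
    intro a L hL j b hj
    obtain ⟨hlt, rfl⟩ := List.getElem?_eq_some_iff.1 hj
    exact (hnd a L hL).idxOf_getElem j hlt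
  intro d a b
  constructor
  · rintro ⟨t, ht, hfit, rfl, rfl⟩
    obtain ⟨L₀, j₀, hL₀, hj₀, -⟩ := h2 t _ _ _ (h.2 t ht)
    have hmem₀ := List.mem_of_getElem? hL₀
    refine ⟨⟨L₀, hmem₀⟩, fun L hL => ?_⟩
    have hb := hsame _ _ _ hmem₀ hL (List.mem_of_getElem? hj₀)
    refine ⟨hb, fun b' hb' => ?_⟩
    obtain ⟨g, hg⟩ := List.mem_iff_getElem?.1 hL
    obtain ⟨j, hj⟩ := List.mem_iff_getElem?.1 hb
    obtain ⟨j', hj'⟩ := List.mem_iff_getElem?.1 hb'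
    obtain ⟨u1, u2, u3, u4⟩ := hpos g _ L hg j _ hj
    obtain ⟨v1, v2, v3, v4⟩ := hpos g _ L hg j' _ hj'
    have := hfit _ u1 u3 u4 _ v1 (v2.trans u2.symm)
    rw [v4] at this
    rw [hidx _ L hL j _ hj, hidx _ L hL j' _ hj']
    exact ⟨fun h => this.1 (by omega), fun h => this.2 (by omega)⟩
  · rintro ⟨⟨L, hL⟩, hdem⟩
    obtain ⟨g, hg⟩ := List.mem_iff_getElem?.1 hL
    obtain ⟨j, hj⟩ := List.mem_iff_getElem?.1 (hdem L hL).1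
    obtain ⟨t1, t2, t3, t4⟩ := hpos g a L hg j b hj
    refine ⟨_, t1, ?_, t3, t4⟩
    intro u hu hua hub v hv hvu
    rw [t3] at hua
    rw [t4] at hub ⊢
    obtain ⟨L₁, j₁, hL₁, hj₁, hu'⟩ := h2 u _ _ _ (h.2 u hu)
    obtain ⟨L₂, j₂, hL₂, hj₂, hv'⟩ := h2 v _ _ _ (h.2 v hv)
    rw [hvu, hL₁] at hL₂
    simp only [Option.some.injEq, Prod.mk.injEq] at hL₂
    obtain ⟨-, rfl⟩ := hL₂
    rw [hua] at hL₁
    rw [hub] at hj₁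
    have hmem := List.mem_of_getElem? hL₁
    have := (hdem L₁ hmem).2 (β v) (List.mem_of_getElem? hj₂)
    rw [hidx _ _ hmem _ _ hj₁, hidx _ _ hmem _ _ hj₂] at this
    rw [hvu] at hv'
    exact ⟨fun h => this.1 (by omega), fun h => this.2 (by omega)⟩

/-- The list `l` stands in the array `w` from the position `q` on. -/
def Reads (w : ℕ → ℕ) (q : ℕ) (l : List ℕ) : Prop :=
  ∀ i x, l[i]? = some x → w (q + i) = x

theorem Reads.cons {w : ℕ → ℕ} {q x : ℕ} {l : List ℕ} (h : Reads w q (x :: l)) :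
    w q = x ∧ Reads w (q + 1) l :=
  ⟨h 0 x rfl, fun i y hi => by
    rw [← h (i + 1) y (by simpa using hi), Nat.add_assoc, Nat.add_comm 1 i]⟩

theorem Reads.append {w : ℕ → ℕ} {q : ℕ} {l l' : List ℕ} (h : Reads w q (l ++ l')) :
    Reads w q l ∧ Reads w (q + l.length) l' := by
  constructor
  · intro i x hi
    exact h i x (by rw [List.getElem?_append_left (List.getElem?_eq_some_iff.1 hi).1, hi])
  · intro i x hi
    rw [Nat.add_assoc]
    refine h _ x ?_
    rw [List.getElem?_append_right (Nat.le_add_right _ _), Nat.add_sub_cancel_left, hi]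

/-- The preference lists of one instance, with the last resort of every agent. -/
def withLastResort (nB : ℕ) (rows : List (List ℕ)) : List (ℕ × List ℕ) :=
  rows.zipIdx.map fun p => (p.2, p.1 ++ [nB + p.2])

theorem withLastResort_append (nB : ℕ) (rows : List (List ℕ)) (l : List ℕ) :
    withLastResort nB (rows ++ [l]) =
      withLastResort nB rows ++ [(rows.length, l ++ [nB + rows.length])] := by
  simp [withLastResort, List.zipIdx_append]

/-- The encoding of preference lists in the input: every list follows its length. -/
def encodeRows (rows : List (List ℕ)) : List ℕ :=
  rows.flatMap fun l => l.length :: l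

/-- Adds an entry for the group, agent and job in the variables `11`, `12` and `14` to the arrays
`1`, `2` and `3`, whose length is in the variable `5`. -/
def addEntry : List Program :=
  [.store 1 5 11, .store 2 5 12, .store 3 5 14, .add 5 5 1]

/-- Reads a preference list from the position in the variable `10` of the input on, and adds the
last resort. -/
def readRow : Program :=
  block [.load 13 0 10, .add 10 10 1,
    countdown 9 13 (block (.load 14 0 10 :: (addEntry ++ [.add 10 10 1]))),
    block (.add 14 3 12 :: (addEntry ++ [.add 11 11 1, .add 12 12 1]))]

/-- Reads the input.  Afterwards the arrays `1`, `2` and `3` hold the entries of all lists, and the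
discounts of the last resorts in the array `5` are `1`. -/
def readInput : Program :=
  block [.const 1 1, .const 9 0, .load 2 0 9, .load 3 0 1, .const 9 2, .load 4 0 9, .add 6 2 3,
    .add 6 6 9, .const 10 3, countdown 7 2 (block [.add 8 3 7, .store 5 8 1]),
    countdown 7 4 (block [.const 12 0, countdown 8 2 readRow])]

theorem haltsWithin_readRow {s : State} {nB q : ℕ} {l : List ℕ} {ℓ : List (ℕ × List ℕ)} {S : ℕ}
    (h1 : s.var 1 = 1) (h3 : s.var 3 = nB) (h10 : s.var 10 = q)
    (h11 : s.var 11 = ℓ.length) (hS : l.length ≤ S) (hr : Reads (s.arr 0) q (l.length :: l))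
    (hH : Holds (s.var 5) (s.arr 1) (s.arr 2) (s.arr 3) (entries ℓ)) :
    HaltsWithin readRow (S * 9 + 15) s fun s' =>
      Holds (s'.var 5) (s'.arr 1) (s'.arr 2) (s'.arr 3)
        (entries (ℓ ++ [(s.var 12, l ++ [nB + s.var 12])])) ∧
      s'.var 10 = q + (l.length + 1) ∧ s'.var 11 = ℓ.length + 1 ∧ s'.var 12 = s.var 12 + 1 := by
  refine HaltsWithin.mono (T₁ := (l.length * 9 + 2) + 9 + 1 + 1) ?_ (by omega) fun _ h => h
  refine .cons_step (by simp) (by simp) (.cons_step (by simp) (by simp) ?_)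
  obtain ⟨hq, hr⟩ := hr.cons
  generalize hs₀ : eval _ _ = s₀
  have w : ∀ x, x ≠ 10 → x ≠ 13 → s₀.var x = s.var x := fun x h h' => by
    simp [← hs₀, h, h']
  have w10 : s₀.var 10 = q + 1 := by simp [← hs₀, h10, h1]
  have w13 : s₀.var 13 = l.length := by simp [← hs₀, h10, hq]
  have warr : s₀.arr = s.arr := by simp [← hs₀]
  refine .cons (T₁ := l.length * 9 + 2) (T₂ := 9) (R := fun s₁ =>
    Holds (s₁.var 5) (s₁.arr 1) (s₁.arr 2) (s₁.arr 3)
      (entries ℓ ++ l.map fun b => (ℓ.length, s.var 12, b)) ∧ s₁.var 10 = q + 1 + l.length) ?_ ?_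
  · refine HaltsWithin.countdown_list (T := 7) l w13 (fun l' s₁ =>
      Holds (s₁.var 5) (s₁.arr 1) (s₁.arr 2) (s₁.arr 3)
        (entries ℓ ++ l'.map fun b => (ℓ.length, s.var 12, b)) ∧ s₁.var 10 = q + 1 + l'.length)
      (by simp [addEntry]) (by simp) (by simp [addEntry])
      ((w 1 (by omega) (by omega)).trans h1) ?_ ?_ ?_
    · intro l s₁ v h
      simpa using h
    · intro l' y r hl s₁ hF hI
      refine .of_loopFree (by simp [addEntry]) (by simp [addEntry]) ?_
      have a1 : s₁.var 1 = 1 :=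
        (hF.var 1 (by simp [addEntry])).trans ((w 1 (by omega) (by omega)).trans h1)
      have a11 : s₁.var 11 = ℓ.length :=
        (hF.var 11 (by simp [addEntry])).trans ((w 11 (by omega) (by omega)).trans h11)
      have a12 : s₁.var 12 = s.var 12 :=
        (hF.var 12 (by simp [addEntry])).trans (w 12 (by omega) (by omega))
      have a0 : s₁.arr 0 (q + 1 + l'.length) = y := by
        rw [hF.arr 0 (by simp [addEntry]), warr]
        exact hr _ y (by rw [hl, List.getElem?_append_right le_rfl, Nat.sub_self]; rfl)
      have := hI.1.append ℓ.length (s.var 12) y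
      rw [List.append_assoc] at this
      rw [Nat.add_assoc] at a0
      simpa [addEntry, a1, a11, a12, hI.2, a0, Nat.add_assoc] using this
    · refine ⟨?_, by simpa using w10⟩
      rw [warr, w 5 (by omega) (by omega)]
      simpa using hH
  · rintro s₁ hF ⟨hI, h10'⟩
    refine .of_loopFree (by simp [addEntry]) (by simp [addEntry]) ?_
    have a1 : s₁.var 1 = 1 :=
      (hF.var 1 (by simp [addEntry])).trans ((w 1 (by omega) (by omega)).trans h1)
    have a3 : s₁.var 3 = nB :=
      (hF.var 3 (by simp [addEntry])).trans ((w 3 (by omega) (by omega)).trans h3)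
    have a11 : s₁.var 11 = ℓ.length :=
      (hF.var 11 (by simp [addEntry])).trans ((w 11 (by omega) (by omega)).trans h11)
    have a12 : s₁.var 12 = s.var 12 :=
      (hF.var 12 (by simp [addEntry])).trans (w 12 (by omega) (by omega))
    have := hI.append ℓ.length (s.var 12) (nB + s.var 12)
    rw [List.append_assoc] at this
    rw [entries_append]
    simp [addEntry, a1, a3, a11, a12, h10']
    exact ⟨this, by omega⟩

/-- A bound for the number of steps of `readInput`. -/
def readTime (nA k S : ℕ) : ℕ := nA * 5 + (k * (nA * (S * 9 + 17) + 6) + 14)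

theorem haltsWithin_readInput {s : State} {nA nB k S : ℕ} {inst : List (List (List ℕ))}
    (hk : inst.length = k) (hA : ∀ rows ∈ inst, rows.length = nA)
    (hS : ∀ rows ∈ inst, ∀ l ∈ rows, l.length ≤ S) (h5 : s.var 5 = 0) (h11 : s.var 11 = 0)
    (h5' : ∀ x, s.arr 5 x = 0)
    (hr : Reads (s.arr 0) 0 (nA :: nB :: k :: inst.flatMap encodeRows)) :
    HaltsWithin readInput (readTime nA k S) s fun s' =>
      s'.var 1 = 1 ∧ s'.var 2 = nA ∧ s'.var 3 = nB ∧ s'.var 6 = nA + nB + 2 ∧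
      Holds (s'.var 5) (s'.arr 1) (s'.arr 2) (s'.arr 3)
        (entries (inst.flatMap (withLastResort nB))) ∧
      ∀ x, s'.arr 5 x = if nB ≤ x ∧ x < nB + nA then 1 else 0 := by
  obtain ⟨r0, hr1⟩ := hr.cons
  obtain ⟨r1, hr2⟩ := hr1.cons
  obtain ⟨r2, hr3⟩ := hr2.cons
  obtain ⟨K, hK⟩ : ∃ K, nA * (S * 9 + 17) = K := ⟨_, rfl⟩
  refine HaltsWithin.mono (T₁ := ((nA * 5 + 2) + ((k * (K + 6) + 2) + (0 + 1))) +
    1 + 1 + 1 + 1 + 1 + 1 + 1 + 1 + 1) ?_ (by rw [readTime, hK]; omega) fun _ h => h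
  iterate 9 refine .cons_step (by simp) (by simp) ?_
  generalize hs₀ : eval _ _ = s₀
  simp only [Nat.zero_add, Nat.reduceAdd] at r0 r1 r2 hr3
  have w1 : s₀.var 1 = 1 := by simp [← hs₀]
  have w2 : s₀.var 2 = nA := by simp [← hs₀, r0]
  have w3 : s₀.var 3 = nB := by simp [← hs₀, r1]
  have w4 : s₀.var 4 = k := by simp [← hs₀, r2]
  have w5 : s₀.var 5 = 0 := by simp [← hs₀, h5]
  have w6 : s₀.var 6 = nA + nB + 2 := by simp [← hs₀, r0, r1]
  have w10 : s₀.var 10 = 3 := by simp [← hs₀]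
  have w11 : s₀.var 11 = 0 := by simp [← hs₀, h11]
  have warr : s₀.arr = s.arr := by simp [← hs₀]
  clear hs₀
  refine .cons (T₁ := nA * 5 + 2) (T₂ := (k * (K + 6) + 2) + (0 + 1)) (R := fun s₁ =>
    ∀ x, s₁.arr 5 x = if nB ≤ x ∧ x < nB + nA then 1 else 0) ?_ ?_
  · rw [← w2]
    refine (HaltsWithin.countdown (T := 3) (fun i s₁ =>
      ∀ x, s₁.arr 5 x = if nB + i ≤ x ∧ x < nB + nA then 1 else 0) (by simp) (by simp) (by simp)
      w1 ?_ ?_ ?_).mono le_rfl fun s₁ h => by simpa [w2] using h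
    · intro i s₁ v h
      simpa using h
    · intro i hi s₁ hF hx hI
      refine .of_loopFree (by simp) (by simp) fun x => ?_
      have a1 : s₁.var 1 = 1 := (hF.var 1 (by simp)).trans w1
      have a3 : s₁.var 3 = nB := (hF.var 3 (by simp)).trans w3
      by_cases hxi : x = nB + i
      · subst hxi
        simp [a1, a3, hx, show i < nA by omega]
      · have := hI x
        simp only [block, eval, State.setVar, State.setArr]
        simp [a3, hx, Function.update_of_ne hxi, this]
        congr 1
        simp only [eq_iff_iff, and_congr_left_iff]
        omega
    · intro x
      rw [warr, h5', if_neg (by omega)]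
  intro s₁ hF h₁
  have a : ∀ x, x ≠ 7 → x ≠ 8 → s₁.var x = s₀.var x := fun x h h' =>
    hF.var x (by simp [h, h'])
  have aarr : ∀ r, r ≠ 5 → s₁.arr r = s.arr r := fun r h => by
    rw [hF.arr r (by simp [h]), warr]
  refine .cons (T₁ := k * (K + 6) + 2) (T₂ := 0 + 1) (R := fun s₂ =>
    Holds (s₂.var 5) (s₂.arr 1) (s₂.arr 2) (s₂.arr 3)
      (entries (inst.flatMap (withLastResort nB)))) ?_ ?_
  · rw [← hk]
    refine (HaltsWithin.countdown_list (T := K + 4) inst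
      (by rw [a 4 (by omega) (by omega), w4, hk]) (fun is s₂ =>
        Holds (s₂.var 5) (s₂.arr 1) (s₂.arr 2) (s₂.arr 3)
          (entries (is.flatMap (withLastResort nB))) ∧
        s₂.var 10 = 3 + (is.flatMap encodeRows).length ∧
        s₂.var 11 = (is.flatMap (withLastResort nB)).length)
      (by simp [readRow, addEntry]) (by simp) (by simp [readRow, addEntry])
      ((a 1 (by omega) (by omega)).trans w1) ?_ ?_ ?_).mono le_rfl fun _ h => h.1
    · intro is s₂ v h
      simpa using h
    · rintro is rows ir hir s₂ hF₂ ⟨hI, b10, b11⟩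
      have b1 : s₂.var 1 = 1 :=
        (hF₂.var 1 (by simp [readRow, addEntry])).trans ((a 1 (by omega) (by omega)).trans w1)
      have b2 : s₂.var 2 = nA :=
        (hF₂.var 2 (by simp [readRow, addEntry])).trans ((a 2 (by omega) (by omega)).trans w2)
      have b3 : s₂.var 3 = nB :=
        (hF₂.var 3 (by simp [readRow, addEntry])).trans ((a 3 (by omega) (by omega)).trans w3)
      have b0 : s₂.arr 0 = s.arr 0 :=
        (hF₂.arr 0 (by simp [readRow, addEntry])).trans (aarr 0 (by omega))
      have hrows : rows ∈ inst := by simp [hir]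
      rw [hir, List.flatMap_append, List.flatMap_cons] at hr3
      obtain ⟨hrr, -⟩ := hr3.append.2.append
      rw [← b10] at hrr
      refine HaltsWithin.mono (T₁ := (K + 2 + (0 + 1)) + 1) ?_ (by omega) fun _ h => h
      refine .cons_step (by simp) (by simp) ?_
      generalize hs₃ : eval _ _ = s₃
      have c : ∀ x, x ≠ 12 → s₃.var x = s₂.var x := fun x h => by simp [← hs₃, h]
      have c12 : s₃.var 12 = 0 := by simp [← hs₃]
      have carr : s₃.arr = s₂.arr := by simp [← hs₃]
      refine .cons (T₁ := K + 2) (T₂ := 0 + 1) ?_ fun s₄ _ h => .nil h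
      rw [← hK, ← hA rows hrows]
      refine (HaltsWithin.countdown_list (T := S * 9 + 15) rows
        (by rw [c 2 (by omega), b2, hA rows hrows]) (fun rs s₄ =>
          Holds (s₄.var 5) (s₄.arr 1) (s₄.arr 2) (s₄.arr 3)
            (entries (is.flatMap (withLastResort nB) ++ withLastResort nB rs)) ∧
          s₄.var 10 = s₂.var 10 + (encodeRows rs).length ∧
          s₄.var 11 = (is.flatMap (withLastResort nB) ++ withLastResort nB rs).length ∧
          s₄.var 12 = rs.length)
        (by simp [readRow, addEntry]) (by simp) (by simp [readRow, addEntry])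
        (by rw [c 1 (by omega), b1]) ?_ ?_ ?_).mono le_rfl ?_
      · intro rs s₄ v h
        simpa using h
      · rintro rs l rr hrs s₄ hF₄ ⟨hI₄, d10, d11, d12⟩
        have hl : l ∈ rows := by simp [hrs]
        have e : encodeRows rows = encodeRows rs ++ ((l.length :: l) ++ encodeRows rr) := by
          simp [hrs, encodeRows]
        rw [e] at hrr
        refine (haltsWithin_readRow (nB := nB) (l := l)
          ((hF₄.var 1 (by simp [readRow, addEntry])).trans (by rw [c 1 (by omega), b1]))
          ((hF₄.var 3 (by simp [readRow, addEntry])).trans (by rw [c 3 (by omega), b3]))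
          d10 d11 (hS rows hrows l hl) ?_ hI₄).mono le_rfl ?_
        · rw [hF₄.arr 0 (by simp [readRow, addEntry]), carr, b0]
          exact hrr.append.2.append.1
        · rintro s₅ ⟨e1, e2, e3, e4⟩
          rw [d12] at e1 e4
          rw [withLastResort_append, ← List.append_assoc]
          refine ⟨e1, ?_, ?_, ?_⟩
          · simp [e2, encodeRows, Nat.add_assoc]
          · rw [e3, List.length_append (bs := [_]), List.length_singleton]
          · simp [e4]
      · rw [carr, c 5 (by omega), c 10 (by omega), c 11 (by omega), c12]
        simpa [withLastResort, encodeRows, b11] using hI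
      · rintro s₄ ⟨e1, e2, e3, -⟩
        simp only [List.flatMap_append, List.flatMap_singleton]
        exact ⟨e1, by rw [e2, b10, List.length_append, Nat.add_assoc], e3⟩
    · rw [a 5 (by omega) (by omega), a 10 (by omega) (by omega), a 11 (by omega) (by omega), w5,
        w10, w11]
      exact ⟨⟨rfl, by simp⟩, by simp, by simp⟩
  · intro s₂ hF₂ h₂
    refine .nil ⟨?_, ?_, ?_, ?_, h₂, ?_⟩
    · rw [hF₂.var 1 (by simp [readRow, addEntry]), a 1 (by omega) (by omega), w1]
    · rw [hF₂.var 2 (by simp [readRow, addEntry]), a 2 (by omega) (by omega), w2]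
    · rw [hF₂.var 3 (by simp [readRow, addEntry]), a 3 (by omega) (by omega), w3]
    · rw [hF₂.var 6 (by simp [readRow, addEntry]), a 6 (by omega) (by omega), w6]
    · rwa [hF₂.arr 5 (by simp [readRow, addEntry])]

end PopularMatching

/-! ### Equilibria of an input and polynomial time -/

namespace PopularMatching

open RandomAccess RandomAccess.Program

theorem idxOf_map_val {n : ℕ} {l : List (Fin n)} (hl : l.Nodup) {b : Fin n} (hb : b ∈ l)
    (x : ℕ) :
    (l.map Fin.val ++ [x]).idxOf b.val = l.idxOf b := by
  have hm : b.val ∈ l.map Fin.val := List.mem_map_of_mem hb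
  rw [List.idxOf_append_of_mem hm]
  have hlt := List.idxOf_lt_length_of_mem hb
  have h1 := (hl.map Fin.val_injective).idxOf_getElem (l.idxOf b) (by simpa using hlt)
  simpa using h1

theorem idxOf_map_val_last {n : ℕ} {l : List (Fin n)} {x : ℕ} (hx : n ≤ x) :
    (l.map Fin.val ++ [x]).idxOf x = l.length := by
  have hm : x ∉ l.map Fin.val := by
    intro h
    obtain ⟨b, -, rfl⟩ := List.mem_map.1 h
    exact absurd b.2 (by omega)
  rw [List.idxOf_append_of_notMem hm]
  simp

/-- The preference lists of the `i`-th instance as lists of numbers. -/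
def Input.rows (x : Input) (i : Fin x.k) : List (List ℕ) :=
  (List.finRange x.nA).map fun a => ((x.inst i).pref a).map Fin.val

/-- All preference lists of the input, with the last resorts. -/
def Input.lists (x : Input) : List (ℕ × List ℕ) :=
  ((List.finRange x.k).map x.rows).flatMap (withLastResort x.nB)

theorem Input.encode_eq (x : Input) :
    x.encode = x.nA :: x.nB :: x.k :: ((List.finRange x.k).map x.rows).flatMap encodeRows := by
  simp only [Input.encode, Input.rows, encodeRows, List.flatMap_map, List.length_map]
  -- the coercion of the entries in `Input.encode` is a monadic bind
  have h : ∀ l : List (Fin x.nB), (List.map (fun b => b) do let a ← l; pure (a : ℕ)) =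
      l.map Fin.val := fun l => by induction l <;> simp_all
  simp only [h]

theorem Input.mem_lists {x : Input} {a : ℕ} {L : List ℕ} : (a, L) ∈ x.lists ↔
    ∃ (i : Fin x.k) (a' : Fin x.nA), a = a' ∧
      L = ((x.inst i).pref a').map Fin.val ++ [x.nB + a'] := by
  simp only [Input.lists, List.mem_flatMap, List.mem_map, List.mem_finRange, true_and,
    withLastResort, exists_exists_eq_and]
  refine exists_congr fun i => ?_
  constructor
  · rintro ⟨⟨l, j⟩, hmem, he⟩
    rw [List.mem_zipIdx_iff_getElem?, Input.rows, List.getElem?_map, Option.map_eq_some_iff] at hmem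
    obtain ⟨a', ha', rfl⟩ := hmem
    obtain ⟨hlt, hja⟩ := List.getElem?_eq_some_iff.1 ha'
    simp only [Prod.mk.injEq] at he
    obtain ⟨rfl, rfl⟩ := he
    have hj : j = a' := by simp [← hja]
    exact ⟨a', hj, by rw [hj]⟩
  · rintro ⟨a', rfl, rfl⟩
    refine ⟨(((x.inst i).pref a').map Fin.val, a'), ?_, rfl⟩
    rw [List.mem_zipIdx_iff_getElem?]
    simp [Input.rows]

theorem Input.nodup_of_mem_lists {x : Input} {a : ℕ} {L : List ℕ} (h : (a, L) ∈ x.lists) :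
    L.Nodup := by
  obtain ⟨i, a, rfl, rfl⟩ := Input.mem_lists.1 h
  rw [List.nodup_append]
  refine ⟨((x.inst i).nodup a).map Fin.val_injective, by simp, ?_⟩
  intro b hb c hc
  obtain ⟨b, -, rfl⟩ := List.mem_map.1 hb
  rw [List.mem_singleton.1 hc]
  omega

theorem Input.subset_of_mem_lists {x : Input} {a : ℕ} {L L' : List ℕ} (h : (a, L) ∈ x.lists)
    (h' : (a, L') ∈ x.lists) : L ⊆ L' := by
  obtain ⟨i, a, rfl, rfl⟩ := Input.mem_lists.1 h
  obtain ⟨j, a', he, rfl⟩ := Input.mem_lists.1 h'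
  obtain rfl := Fin.ext he
  intro b hb
  rcases List.mem_append.1 hb with hb | hb
  · obtain ⟨c, hc, rfl⟩ := List.mem_map.1 hb
    exact List.mem_append_left _ (List.mem_map_of_mem ((x.same_graph i j a c).1 hc))
  · exact List.mem_append_right _ hb

theorem Input.bounds_of_mem_lists {x : Input} (a : ℕ) (L : List ℕ) (h : (a, L) ∈ x.lists) :
    a < x.nA ∧ ∀ b ∈ L, b < x.nB ∨ b = x.nB + a := by
  obtain ⟨i, a, rfl, rfl⟩ := Input.mem_lists.1 h
  refine ⟨a.2, fun b hb => ?_⟩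
  rcases List.mem_append.1 hb with hb | hb
  · obtain ⟨b, -, rfl⟩ := List.mem_map.1 hb
    exact .inl b.2
  · exact .inr (List.mem_singleton.1 hb)

theorem Input.demands_job_iff {x : Input} {d : ℕ → ℕ} (hd : ∀ a < x.nA, d (x.nB + a) = 1)
    (a : Fin x.nA) (b : Fin x.nB) : Demands x.lists d a b ↔
      ∀ i, (x.inst i).Adj a b ∧ ∀ b' : Fin x.nB,
        ((x.inst i).Better a b' b → d b' < d b) ∧ ((x.inst i).Better a b b' → d b' ≤ d b + 1) := by
  constructor
  · rintro ⟨-, h⟩ i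
    obtain ⟨h1, h2⟩ := h _ (Input.mem_lists.2 ⟨i, a, rfl, rfl⟩)
    have hb : b ∈ (x.inst i).pref a := by
      rcases List.mem_append.1 h1 with h1 | h1
      · obtain ⟨b', hb', he⟩ := List.mem_map.1 h1
        rwa [← Fin.ext he]
      · exact absurd (List.mem_singleton.1 h1) (by omega)
    refine ⟨hb, fun b' => ⟨fun hbb => ?_, fun hbb => ?_⟩⟩
    · refine (h2 b' (List.mem_append_left _ (List.mem_map_of_mem hbb.1))).1 ?_
      rw [idxOf_map_val ((x.inst i).nodup a) hb, idxOf_map_val ((x.inst i).nodup a) hbb.1]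
      exact hbb.2.2
    · refine (h2 b' (List.mem_append_left _ (List.mem_map_of_mem hbb.2.1))).2 ?_
      rw [idxOf_map_val ((x.inst i).nodup a) hb,
        idxOf_map_val ((x.inst i).nodup a) hbb.2.1]
      exact hbb.2.2
  · intro h
    refine ⟨⟨_, Input.mem_lists.2 ⟨⟨0, x.k_pos⟩, a, rfl, rfl⟩⟩, fun L hL => ?_⟩
    obtain ⟨i, a', he, rfl⟩ := Input.mem_lists.1 hL
    obtain rfl := Fin.ext he
    obtain ⟨hb, h2⟩ := h i
    refine ⟨List.mem_append_left _ (List.mem_map_of_mem hb), fun b' hb' => ?_⟩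
    rw [idxOf_map_val ((x.inst i).nodup a) hb]
    rcases List.mem_append.1 hb' with hb' | hb'
    · obtain ⟨c, hc, rfl⟩ := List.mem_map.1 hb'
      rw [idxOf_map_val ((x.inst i).nodup a) hc]
      exact ⟨fun hlt => (h2 c).1 ⟨hc, hb, hlt⟩, fun hlt => (h2 c).2 ⟨hb, hc, hlt⟩⟩
    · rw [List.mem_singleton.1 hb', idxOf_map_val_last (by omega), hd a a.2]
      exact ⟨fun hlt => absurd hlt (not_lt.2 List.idxOf_le_length), fun _ => by omega⟩

theorem Input.demands_last_iff {x : Input} {d : ℕ → ℕ} (hd : ∀ a < x.nA, d (x.nB + a) = 1)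
    (a : Fin x.nA) : Demands x.lists d a (x.nB + a) ↔
      ∀ i (b : Fin x.nB), (x.inst i).Adj a b → d b = 0 := by
  constructor
  · rintro ⟨-, h⟩ i b hb
    obtain ⟨-, h2⟩ := h _ (Input.mem_lists.2 ⟨i, a, rfl, rfl⟩)
    have := (h2 b (List.mem_append_left _ (List.mem_map_of_mem hb))).1 ?_
    · rw [hd a a.2] at this
      omega
    · rw [idxOf_map_val ((x.inst i).nodup a) hb, idxOf_map_val_last (by omega)]
      exact List.idxOf_lt_length_of_mem hb
  · intro h
    refine ⟨⟨_, Input.mem_lists.2 ⟨⟨0, x.k_pos⟩, a, rfl, rfl⟩⟩, fun L hL => ?_⟩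
    obtain ⟨i, a', he, rfl⟩ := Input.mem_lists.1 hL
    obtain rfl := Fin.ext he
    refine ⟨List.mem_append_right _ (List.mem_singleton_self _), fun b' hb' => ?_⟩
    rcases List.mem_append.1 hb' with hb' | hb'
    · obtain ⟨c, hc, rfl⟩ := List.mem_map.1 hb'
      rw [h i c hc, hd a a.2]
      omega
    · rw [List.mem_singleton.1 hb']
      omega

/-- The matchings that are popular in all instances are the equilibria, with the unmatched agents
getting their last resorts. -/
theorem Input.hasRobustPopularMatching_iff (x : Input) :
    x.HasRobustPopularMatching ↔ ∃ α f, IsEquilibrium x.lists x.nA x.nB α f := by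
  classical
  constructor
  · rintro ⟨M, hM⟩
    have : Nonempty (Fin x.k) := ⟨⟨0, x.k_pos⟩⟩
    obtain ⟨d, hd⟩ := exists_certifies x.same_graph x.one_agent hM
    have hM₀ := (hM ⟨0, x.k_pos⟩).1
    let α : ℕ → ℕ := fun b => if h : b < x.nB then d ⟨b, h⟩ else 1
    have hα : ∀ b : Fin x.nB, α b = d b := fun b => by simp [α]
    have hlast : ∀ a < x.nA, α (x.nB + a) = 1 := fun a _ => by simp [α]
    have hf : ∀ a : ℕ, ∃ c : ℕ, ∀ h : a < x.nA,
        (∃ b, (⟨a, h⟩, b) ∈ M ∧ c = b) ∨ ((∀ b, (⟨a, h⟩, b) ∉ M) ∧ c = x.nB + a) := by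
      intro a
      by_cases h : ∃ (h : a < x.nA) (b : Fin x.nB), (⟨a, h⟩, b) ∈ M
      · obtain ⟨h, b, hb⟩ := h
        exact ⟨b, fun _ => .inl ⟨b, hb, rfl⟩⟩
      · push Not at h
        exact ⟨x.nB + a, fun ha => .inr ⟨h ha, rfl⟩⟩
    choose f hf using hf
    refine ⟨α, f, fun b hb => ?_, hlast, ?_, ?_, ?_⟩
    · rw [hα ⟨b, hb⟩]
      exact hd.le_two _
    · intro a ha a' ha' he
      rcases hf a ha with ⟨b, hb, e⟩ | ⟨-, e⟩ <;> rcases hf a' ha' with ⟨b', hb', e'⟩ | ⟨-, e'⟩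
      · have : b = b' := Fin.ext (by omega)
        subst this
        exact congrArg Fin.val (hM₀.right_unique _ _ _ hb hb')
      · omega
      · omega
      · omega
    · intro a ha
      rcases hf a ha with ⟨b, hb, e⟩ | ⟨hun, e⟩
      · rw [e]
        refine (Input.demands_job_iff hlast ⟨a, ha⟩ b).2 fun i => ⟨(hM i).1.edge _ _ hb, fun b' => ?_⟩
        rw [hα, hα]
        exact ⟨hd.better i _ _ _ hb, hd.worse i _ _ _ hb⟩
      · rw [e]
        refine (Input.demands_last_iff hlast ⟨a, ha⟩).2 fun i b hab => ?_
        rw [hα]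
        exact hd.unmatched_agent i _ _ hun hab
    · intro b hb hαb
      rw [hα ⟨b, hb⟩] at hαb
      have : ∃ a, (a, (⟨b, hb⟩ : Fin x.nB)) ∈ M := by
        by_contra! hun
        have := hd.unmatched_job ⟨b, hb⟩ hun
        omega
      obtain ⟨a, ha⟩ := this
      refine ⟨a, a.2, ?_⟩
      rcases hf a a.2 with ⟨b', hb', e⟩ | ⟨hun, e⟩
      · rw [e, hM₀.left_unique _ _ _ hb' ha]
      · exact absurd ha (hun _)
  · rintro ⟨α, f, h⟩
    let M : Finset (Fin x.nA × Fin x.nB) := Finset.univ.filter fun e => f e.1 = e.2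
    have hMem : ∀ a b, (a, b) ∈ M ↔ f a = b := fun a b => by simp [M]
    have hdem : ∀ a b, (a, b) ∈ M → ∀ i, (x.inst i).Adj a b ∧ ∀ b' : Fin x.nB,
        ((x.inst i).Better a b' b → α b' < α b) ∧
          ((x.inst i).Better a b b' → α b' ≤ α b + 1) := by
      intro a b hab
      have := h.demands a a.2
      rw [(hMem a b).1 hab] at this
      exact (Input.demands_job_iff h.last a b).1 this
    have hM : ∀ i, (x.inst i).IsMatching M := fun i =>
      { edge := fun a b hab => (hdem a b hab i).1
        left_unique := fun a b b' hb hb' =>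
          Fin.ext (((hMem a b).1 hb).symm.trans ((hMem a b').1 hb'))
        right_unique := fun a a' b ha ha' =>
          Fin.ext (h.inj a.2 a'.2 (((hMem a b).1 ha).trans ((hMem a' b).1 ha').symm)) }
    have hcert : Certifies x.inst M fun b => α b :=
      { le_two := fun b => h.le_two b b.2
        unmatched_job := fun b hb => by
          by_contra hne
          have h2 := h.le_two b b.2
          obtain ⟨a, ha, hab⟩ := h.cover b b.2 (by omega)
          exact hb ⟨a, ha⟩ ((hMem _ _).2 hab)
        better := fun i a b b' hab hbb => ((hdem a b hab i).2 b').1 hbb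
        worse := fun i a b b' hab hbb => ((hdem a b hab i).2 b').2 hbb
        unmatched_agent := fun i a b hun hab => by
          have hda := h.demands a a.2
          obtain ⟨L, hL⟩ := hda.1
          have hfL := (Input.bounds_of_mem_lists _ _ hL).2 _ (hda.2 L hL).1
          have hfa : f a = x.nB + a := by
            rcases hfL with hlt | he
            · exact absurd ((hMem a ⟨f a, hlt⟩).2 rfl) (hun _)
            · exact he
          rw [hfa] at hda
          exact (Input.demands_last_iff h.last a).1 hda i b hab }
    exact ⟨M, fun i => hcert.isPopular i (hM i)⟩

theorem length_entries (ℓ : List (ℕ × List ℕ)) :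
    (entries ℓ).length = (ℓ.map fun p => p.2.length).sum := by
  induction ℓ using List.reverseRecOn with
  | nil => rfl
  | append_singleton ℓ p ih =>
    obtain ⟨a, L⟩ := p
    simp [entries_append, ih]

theorem Input.length_entries_lists (x : Input) :
    (entries x.lists).length = (∑ i, ∑ a, ((x.inst i).pref a).length) + x.k * x.nA := by
  rw [length_entries, Input.lists]
  have h : ∀ i, ((withLastResort x.nB (x.rows i)).map fun p => p.2.length).sum =
      ∑ a, (((x.inst i).pref a).length + 1) := by
    intro i
    have : (withLastResort x.nB (x.rows i)).map (fun p => p.2.length) =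
        (x.rows i).map fun l => l.length + 1 := by
      rw [withLastResort, List.map_map]
      conv_rhs => rw [← List.zipIdx_map_fst 0 (x.rows i), List.map_map]
      refine List.map_congr_left fun p _ => by simp
    rw [this, Input.rows, List.map_map, ← List.ofFn_eq_map, List.sum_ofFn]
    simp
  rw [List.flatMap, List.map_flatten, List.sum_flatten, List.map_map, List.map_map, List.map_map,
    ← List.ofFn_eq_map, List.sum_ofFn]
  simp only [Function.comp_apply, h, Finset.sum_add_distrib]
  simp

theorem isLowerBound_init {ℓ : List (ℕ × List ℕ)} {nA nB : ℕ} {d : ℕ → ℕ}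
    (hd : ∀ x, d x = if nB ≤ x ∧ x < nB + nA then 1 else 0) : IsLowerBound ℓ nA nB d where
  le_two b hb := by rw [hd, if_neg (by omega)]; omega
  last a ha := by rw [hd, if_pos (by omega)]
  le α f h x := by
    rw [hd]
    split_ifs with hx
    · have := h.last (x - nB) (by omega)
      rw [Nat.add_sub_cancel' hx.1] at this
      exact this.ge
    · exact Nat.zero_le _

theorem haltsWithin_decide (x : Input) :
    HaltsWithin (.seq readInput auction)
      (readTime x.nA x.k x.size + ((2 * x.nB + 1) * (markTime (entries x.lists).length +
        (matchTime (entries x.lists).length (x.nA + x.nB + 2) x.nB + 9)) +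
        matchTime (entries x.lists).length (x.nA + x.nB + 2) x.nA + 10))
      (State.init x.encode) fun s => s.var 0 ≠ 0 ↔ x.HasRobustPopularMatching := by
  refine (haltsWithin_readInput (nA := x.nA) (nB := x.nB) (k := x.k) (S := x.size)
    (inst := (List.finRange x.k).map x.rows) (by simp) ?_ ?_ rfl rfl (fun _ => rfl) ?_).seq ?_
  · intro rows hrows
    obtain ⟨i, -, rfl⟩ := List.mem_map.1 hrows
    simp [Input.rows]
  · intro rows hrows l hl
    obtain ⟨i, -, rfl⟩ := List.mem_map.1 hrows
    obtain ⟨a, -, rfl⟩ := List.mem_map.1 hl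
    rw [List.length_map]
    have h1 := Finset.single_le_sum (f := fun a => ((x.inst i).pref a).length)
      (fun _ _ => Nat.zero_le _) (Finset.mem_univ a)
    have h2 := Finset.single_le_sum (f := fun i => ∑ a, ((x.inst i).pref a).length)
      (fun _ _ => Nat.zero_le _) (Finset.mem_univ i)
    simp only [Input.size] at h1 h2 ⊢
    omega
  · rw [← Input.encode_eq]
    intro i y hi
    simp [State.init, hi]
  · rintro s hF ⟨h1, h2, h3, h6, hH, h5⟩
    rw [x.hasRobustPopularMatching_iff]
    have hH' : Holds (s.var 5) (s.arr 1) (s.arr 2) (s.arr 3) (entries x.lists) := hH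
    refine haltsWithin_auction h1 h2 h3 hH'.1 h6 ?_ ?_ Input.bounds_of_mem_lists
      (isLowerBound_init h5)
    · rw [← hH'.1]
      exact hH'.represents (fun a L h => Input.nodup_of_mem_lists h)
        (fun a L L' h h' => Input.subset_of_mem_lists h h')
    · intro a
      rw [hF.arr 4 (by simp [readInput, readRow, addEntry])]
      rfl

end PopularMatching

theorem mainTheorem7 :
    RandomAccess.PolyTimeDecidable PopularMatching.Input.encode PopularMatching.Input.size
      PopularMatching.Input.HasRobustPopularMatching := by
  open PopularMatching Polynomial in
  let M : ℕ[X] := X + X * X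
  let N : ℕ[X] := X + 2
  let R : ℕ[X] := N * 5 + 2 + (X * ((N * N + 1) * (M * 22 + 21) + 12) + 6)
  refine ⟨.seq readInput auction, X * 5 + (X * (X * (X * 9 + 17) + 6) + 14) +
    ((2 * X + 1) * (M * (M * (M * 29 + 22) + 12) + 2 + (R + 9)) + R + 10), fun x => ?_⟩
  obtain ⟨t, s, hexec, ht, hs⟩ := haltsWithin_decide x
  refine ⟨t, s, hexec, ht.trans ?_, hs⟩
  have hA : x.nA ≤ x.size := by simp only [Input.size]; omega
  have hB : x.nB ≤ x.size := by simp only [Input.size]; omega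
  have hk : x.k ≤ x.size := by simp only [Input.size]; omega
  have hAB : x.nA + x.nB + 2 ≤ x.size + 2 := by simp only [Input.size]; omega
  have hm : (entries x.lists).length ≤ x.size + x.size * x.size := by
    rw [Input.length_entries_lists]
    exact Nat.add_le_add (by simp only [Input.size]; omega) (Nat.mul_le_mul hk hA)
  simp only [M, N, R, eval_add, eval_mul, eval_X, eval_ofNat, eval_one, readTime, markTime,
    matchTime]
  gcongr
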